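/- **Conventions.** Let $A$ be a $C^*$-algebra, not necessarily unital. $\mathcal U(A)$ denotes the unitary group of $A$ if $A$ is unital, and the unitary group of $A+\mathbb C1$ if $A$ is not unital; $\mathrm{Ad}\,u(x)=uxu^*$. An automorphism $\alpha$ of $A$ is *approximately inner* if it lies in the closure of $\{\mathrm{Ad}\,u : u\in\mathcal U(A)\}$ for the topology of pointwise norm convergence. $\mathrm{AI}(A)$ is the group of *asymptotically inner* automorphisms, i.e. of those approximately inner automorphisms $\alpha$ for which there is a norm-continuous path $(u_t)_{t\in[0,1)}$ in $\mathcal U(A)$ with $\alpha(x)=\lim_{t\to1}\mathrm{Ad}\,u_t(x)$ for all $x\in A$. Irreducible representations on Hilbert spaces are understood to be nonzero; two representations are disjoint if there is no nonzero bounded intertwiner between them; $\omega\sim\varphi$ (resp. $\omega,\varphi$ disjoint) for pure states means that their GNS representations are unitarily equivalent (resp. disjoint). Equality of representations below means unitary equivalence. **Property (S).** $A$ has Property (S) if for any finite subset $F$ of $A$ and $\varepsilon>0$ there exist a finite subset $G$ of $A$ and $\delta>0$ such that: if $B$ is a $C^*$-algebra containing $A$ as a $C^*$-subalgebra and $\omega_1,\dots,\omega_n,\varphi_1,\dots,\varphi_n$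 are pure states of $B$ such that (1) the $\omega_i$ are mutually disjoint, (2) $\omega_i\sim\varphi_i$ for all $i$, (3) $|\omega_i(x)-\varphi_i(x)|<\delta$ for $x\in G$ and all $i$, then there is a norm-continuous path $(u_t)_{t\in[0,1]}$ in $\mathcal U(B)$ such that $u_0=1$, $\omega_i=\varphi_i\circ\mathrm{Ad}\,u_1$ for all $i$, and $\|\mathrm{Ad}\,u_t(x)-x\|<\varepsilon$ for $x\in F$ and $t\in[0,1]$. **Theorem.** Let $A$ be a separable $C^*$-algebra with Property (S). Let $(\pi_n)_{n\in\mathbb N}$ and $(\rho_n)_{n\in\mathbb N}$ be sequences of irreducible representations of $A$ such that the $\pi_n$ are mutually disjoint, the $\rho_n$ are mutually disjoint, and $\ker\pi_n=\ker\rho_n$ for all $n$. Then there is an $\alpha\in\mathrm{AI}(A)$ such that $\pi_n=\rho_n\circ\alpha$ (up to unitary equivalence) for all $n\in\mathbb N$. In particular, if $(\pi_n)_{n\in\mathbb Z}$ are mutually disjoint irreducible representations of $A$ whose kernels $\ker\pi_n$ are all equal, then there is an $\alpha\in\mathrm{AI}(A)$ such that $\pi_n\circ\alpha=\pi_{n+1}$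 (up to unitary equivalence) for all $n\in\mathbb Z$. -/

import Mathlib

open scoped ComplexOrder Topology

noncomputable section

namespace PureTransitivity

universe u v w

section Representations

variable {A : Type u} [NonUnitalCStarAlgebra A]
variable {H : Type v} [NormedAddCommGroup H] [InnerProductSpace ℂ H] [CompleteSpace H]
variable {K : Type w} [NormedAddCommGroup K] [InnerProductSpace ℂ K] [CompleteSpace K]

/-- A representation of `A` on a Hilbert space `H` is a `*`-homomorphism `A →⋆ₙₐ[ℂ] (H →L[ℂ] H)`.
It is irreducible if it is nonzero and the only closed invariant subspaces are `0` and `H`. -/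
def IsIrreducible (π : A →⋆ₙₐ[ℂ] (H →L[ℂ] H)) : Prop :=
  π ≠ 0 ∧ ∀ V : Submodule ℂ H, IsClosed (V : Set H) → (∀ a : A, ∀ x ∈ V, π a x ∈ V) →
    V = ⊥ ∨ V = ⊤

/-- Unitary equivalence of representations. -/
def Equivalent (π : A →⋆ₙₐ[ℂ] (H →L[ℂ] H)) (ρ : A →⋆ₙₐ[ℂ] (K →L[ℂ] K)) : Prop :=
  ∃ U : H ≃ₗᵢ[ℂ] K, ∀ (a : A) (x : H), U (π a x) = ρ a (U x)

/-- Disjointness of representations: there is no nonzero bounded intertwiner. -/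
def DisjointRep (π : A →⋆ₙₐ[ℂ] (H →L[ℂ] H)) (ρ : A →⋆ₙₐ[ℂ] (K →L[ℂ] K)) : Prop :=
  ∀ T : H →L[ℂ] K, (∀ (a : A) (x : H), T (π a x) = ρ a (T x)) → T = 0

/-- The kernel of a representation, as a subset of `A`. -/
def repKer (π : A →⋆ₙₐ[ℂ] (H →L[ℂ] H)) : Set A := {a | π a = 0}

end Representations

section Unitaries

/-- `A` has a (two-sided) unit element. -/
def HasUnit (A : Type u) [NonUnitalCStarAlgebra A] : Prop :=
  ∃ e : A, ∀ a : A, e * a = a ∧ a * e = a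

/-- The unitary group `U(A)`: the unitary group of `A` if `A` is unital, and the unitary group of
`A + ℂ1` otherwise.  Both are realised inside the unitary group of `Unitization ℂ A = A + ℂ1`:
if `A` has a unit `e`, then `v ↦ v + (1 - e)` identifies (isometrically) the unitary group of `A`
with the unitaries of `Unitization ℂ A` whose scalar part is `1`. -/
def unitaryGroup (A : Type u) [NonUnitalCStarAlgebra A] : Subgroup (unitary (Unitization ℂ A)) where
  carrier := {u | HasUnit A → (u : Unitization ℂ A).fst = 1}
  one_mem' := fun _ => by simp
  mul_mem' := fun {a b} ha hb h => by simp [ha h, hb h]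
  inv_mem' := fun {a} ha h => by
    change (star (a : Unitization ℂ A)).fst = 1
    simp [ha h]

variable {A : Type u} [NonUnitalCStarAlgebra A]

/-- `Ad u (x) = u x u*`, which lies in `A` (see `inr_Ad`), for `u ∈ U(A)` and `x ∈ A`. -/
def Ad (u : unitaryGroup A) (x : A) : A :=
  ((u : Unitization ℂ A) * (x : Unitization ℂ A) * star (u : Unitization ℂ A)).snd

theorem inr_Ad (u : unitaryGroup A) (x : A) :
    ((Ad u x : A) : Unitization ℂ A) = (u : Unitization ℂ A) * x * star (u : Unitization ℂ A) := by
  ext <;> simp [Ad]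

/-- For unital `C`, every unitary `v` of `C` gives an element of `unitaryGroup C`
that implements the usual `x ↦ v x v*`. -/
theorem exists_unitaryGroup_of_unital {C : Type u} [CStarAlgebra C] (v : unitary C) :
    ∃ u : unitaryGroup C,
      (u : Unitization ℂ C) = Unitization.inl 1 + Unitization.inr ((v : C) - 1) ∧
      ∀ x : C, Ad u x = v * x * star (v : C) := by
  have h1 : star (v : C) * v = 1 := Unitary.coe_star_mul_self v
  have h2 : (v : C) * star (v : C) = 1 := Unitary.coe_mul_star_self v
  obtain ⟨a, ha⟩ : ∃ a : C, (v : C) = 1 + a := ⟨v - 1, by abel⟩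
  rw [ha] at h1 h2 ⊢
  simp only [add_sub_cancel_left]
  simp only [star_add, star_one, add_mul, mul_add, one_mul, mul_one] at h1 h2
  refine ⟨⟨⟨Unitization.inl 1 + Unitization.inr a, ?_⟩, ?_⟩, rfl, ?_⟩
  · rw [Unitary.mem_iff]
    constructor <;> ext <;> simp
    · rw [← add_right_inj (1 : C), add_zero]; refine Eq.trans ?_ h1; abel
    · rw [← add_right_inj (1 : C), add_zero]; refine Eq.trans ?_ h2; abel
  · intro _
    simp
  · intro x
    simp [Ad, mul_add, add_mul]

/-- For unital `C`, every element of `unitaryGroup C` comes from a unitary of `C`. -/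
theorem exists_unitary_of_unital {C : Type u} [CStarAlgebra C] (u : unitaryGroup C) :
    ∃ v : unitary C, (u : Unitization ℂ C) = Unitization.inl 1 + Unitization.inr ((v : C) - 1) := by
  have hf : (u : Unitization ℂ C).fst = 1 := u.2 ⟨1, fun a => by simp⟩
  have h1 : star (u : Unitization ℂ C) * u = 1 := Unitary.coe_star_mul_self u.1
  have h2 : (u : Unitization ℂ C) * star (u : Unitization ℂ C) = 1 :=
    Unitary.coe_mul_star_self u.1
  generalize (u : Unitization ℂ C) = z at hf h1 h2 ⊢
  replace h1 := congrArg (fun z : Unitization ℂ C => z.snd) h1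
  replace h2 := congrArg (fun z : Unitization ℂ C => z.snd) h2
  simp [hf] at h1 h2
  refine ⟨⟨1 + z.snd, ?_⟩, ?_⟩
  · rw [Unitary.mem_iff]
    simp only [star_add, star_one, add_mul, mul_add, one_mul, mul_one]
    constructor
    · refine Eq.trans ?_ ((congrArg (fun y => 1 + y) h1).trans (add_zero 1)); abel
    · refine Eq.trans ?_ ((congrArg (fun y => 1 + y) h2).trans (add_zero 1)); abel
  · simp only [add_sub_cancel_left]
    ext <;> simp [hf]

/-- Approximately inner automorphisms: the closure of `{Ad u | u ∈ U(A)}` in the group of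
automorphisms for the topology of pointwise norm convergence. -/
def IsApproximatelyInner (α : A ≃⋆ₐ[ℂ] A) : Prop :=
  ∀ (F : Finset A) (ε : ℝ), 0 < ε → ∃ u : unitaryGroup A, ∀ x ∈ F, ‖Ad u x - α x‖ < ε

/-- Asymptotically inner automorphisms: approximately inner automorphisms `α` such that
`α = lim_{t → 1} Ad u_t` (pointwise in norm) for some norm-continuous path `(u_t)`, `t ∈ [0,1)`,
in `U(A)`. -/
def IsAsymptoticallyInner (α : A ≃⋆ₐ[ℂ] A) : Prop :=
  IsApproximatelyInner α ∧
    ∃ u : ℝ → unitaryGroup A, ContinuousOn u (Set.Ico 0 1) ∧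
      ∀ x : A, Filter.Tendsto (fun t => Ad (u t) x) (𝓝[<] 1) (𝓝 (α x))

end Unitaries

section States

variable {B : Type u} [NonUnitalCStarAlgebra B] [PartialOrder B] [StarOrderedRing B]

variable (B) in
/-- The states of `B`: positive linear functionals of norm one. -/
def stateSpace : Set (B →L[ℂ] ℂ) := {f | (∀ a : B, 0 ≤ a → 0 ≤ f a) ∧ ‖f‖ = 1}

/-- A positive linear functional is a pure state if it is an extreme point of the set of states. -/
def IsPureState (ω : B →ₚ[ℂ] ℂ) : Prop :=
  ∃ f ∈ Set.extremePoints ℝ (stateSpace B), ∀ a : B, f a = ω a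

/-- `ω ∼ φ`: the GNS representations are unitarily equivalent. -/
def EquivalentStates (ω φ : B →ₚ[ℂ] ℂ) : Prop :=
  Equivalent ω.gnsNonUnitalStarAlgHom φ.gnsNonUnitalStarAlgHom

/-- `ω` and `φ` are disjoint: the GNS representations are disjoint. -/
def DisjointStates (ω φ : B →ₚ[ℂ] ℂ) : Prop :=
  DisjointRep ω.gnsNonUnitalStarAlgHom φ.gnsNonUnitalStarAlgHom

end States

/-- The strong transitivity property of a C*-algebra `A`.  The overalgebras `B ⊇ A` are given by
injective (hence isometric) `*`-homomorphisms `ι : A → B`, not necessarily unital.  The order on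
`B` is the usual one, as `StarOrderedRing B` determines it. -/
def StrongTransitivityProperty (A : Type u) [NonUnitalCStarAlgebra A] : Prop :=
  ∀ (F : Finset A) (ε : ℝ), 0 < ε → ∃ (G : Finset A) (δ : ℝ), 0 < δ ∧
    ∀ (B : Type u) [NonUnitalCStarAlgebra B] [PartialOrder B] [StarOrderedRing B]
      (ι : A →⋆ₙₐ[ℂ] B), Function.Injective ι →
    ∀ (n : ℕ) (ω φ : Fin n → (B →ₚ[ℂ] ℂ)),
      (∀ i, IsPureState (ω i)) → (∀ i, IsPureState (φ i)) →
      (Pairwise fun i j => DisjointStates (ω i) (ω j)) →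
      (∀ i, EquivalentStates (ω i) (φ i)) →
      (∀ i, ∀ x ∈ G, ‖ω i (ι x) - φ i (ι x)‖ < δ) →
      ∃ u : C(unitInterval, unitaryGroup B),
        u 0 = 1 ∧
        (∀ i, ∀ b : B, ω i b = φ i (Ad (u 1) b)) ∧
        ∀ t, ∀ x ∈ F, ‖Ad (u t) (ι x) - ι x‖ < ε

end PureTransitivity

end

/-!
The automorphism is built by a back-and-forth argument with vector states.

A vector state of an irreducible representation is pure, and its GNS representation is that
representation (`IsIrreducible.isPureState_vecState`, `IsIrreducible.equivalent_gns`). If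
`ker π = ker ρ`, every vector state of `π` is a weak* limit of vector states of `ρ`: comparing
upper bounds of quadratic forms through the functional calculus, no weak* continuous functional
separates it from the vector functionals of `ρ`, and Milman's converse to the Krein–Milman theorem
passes from the closed convex hull to the closure (`IsIrreducible.exists_vecState_close`).

Start with vector states `θ 0 i` of `π i`, and choose in turn families `θ 1, θ 2, …` of vector
states, those with even index belonging to the `π i` and those with odd index to the `ρ i`, each
family so close to the preceding one on a finite set `G k` that `θ (k + 2)` is close to `θ k` there.
The transitivity property, applied inside `A` to the first `k` states, provides a unitary path from
`1` to some `U k` with `θ k i = θ (k + 2) i ∘ Ad (U k)` for `i < k`, which moves only slightly an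
initial part of a dense sequence and its image under the product of the previous unitaries of the
same parity. Hence the products over even and over odd indices converge, along continuous paths, to
automorphisms `E` and `O` (`exists_tendsto_Ad_path`). As `θ (2 m)` and `θ (2 m + 1)` get arbitrarily
close, `α = O⁻¹ ∘ E` carries vector states of `ρ i` to vector states of `π i` up to inner
automorphisms (`exists_isAsymptoticallyInner_of_isApproximatedBy`), and so `π i` is equivalent to
`ρ i ∘ α` (`IsIrreducible.equivalent_comp`). Since only the equivalence classes of the
representations matter, the initial states need not be moved by unitaries, and the construction
does without the Kadison transitivity theorem.

The statement about a sequence indexed by `ℤ` compares the sequence with its shift.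
-/

noncomputable section

namespace PureTransitivity

universe u v w

/-! ### Irreducible representations -/

section Representations

variable {A : Type u} [NonUnitalCStarAlgebra A]
variable {H : Type v} [NormedAddCommGroup H] [InnerProductSpace ℂ H] [CompleteSpace H]
variable {K : Type w} [NormedAddCommGroup K] [InnerProductSpace ℂ K] [CompleteSpace K]
variable {π : A →⋆ₙₐ[ℂ] (H →L[ℂ] H)} {σ : A →⋆ₙₐ[ℂ] (K →L[ℂ] K)}

/-- The orbit map `a ↦ π a ξ` of a vector. -/
def orbitMap (π : A →⋆ₙₐ[ℂ] (H →L[ℂ] H)) (ξ : H) : A →ₗ[ℂ] H where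
  toFun a := π a ξ
  map_add' a b := by simp
  map_smul' c a := by simp

@[simp]
lemma orbitMap_apply (π : A →⋆ₙₐ[ℂ] (H →L[ℂ] H)) (ξ : H) (a : A) : orbitMap π ξ a = π a ξ := rfl

lemma norm_map_apply_le (π : A →⋆ₙₐ[ℂ] (H →L[ℂ] H)) (a : A) (x : H) :
    ‖π a x‖ ≤ ‖a‖ * ‖x‖ :=
  (π a).le_of_opNorm_le (NonUnitalStarAlgHom.norm_apply_le π a) x

lemma inner_map_star (π : A →⋆ₙₐ[ℂ] (H →L[ℂ] H)) (a : A) (x y : H) :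
    inner ℂ x (π (star a) y) = inner ℂ (π a x) y := by
  rw [map_star, ContinuousLinearMap.star_eq_adjoint, ContinuousLinearMap.adjoint_inner_right]

lemma inner_map_star_mul (π : A →⋆ₙₐ[ℂ] (H →L[ℂ] H)) (a b : A) (x : H) :
    inner ℂ x (π (star a * b) x) = inner ℂ (π a x) (π b x) := by
  rw [map_mul, mul_apply_eq_comp, inner_map_star]

lemma norm_map_apply_sq (π : A →⋆ₙₐ[ℂ] (H →L[ℂ] H)) (a : A) (x : H) :
    inner ℂ x (π (star a * a) x) = (‖π a x‖ : ℂ) ^ 2 := by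
  rw [inner_map_star_mul, inner_self_eq_norm_sq_to_K]; rfl

/-- Every nonzero vector of an irreducible representation is cyclic. -/
lemma IsIrreducible.denseRange_orbitMap (hπ : IsIrreducible π) {ξ : H} (hξ : ξ ≠ 0) :
    DenseRange (orbitMap π ξ) := by
  have hinv : ∀ a : A, ∀ x ∈ (LinearMap.range (orbitMap π ξ)).topologicalClosure,
      π a x ∈ (LinearMap.range (orbitMap π ξ)).topologicalClosure := by
    intro a x hx
    have : Set.MapsTo (π a) (LinearMap.range (orbitMap π ξ) : Set H)
        (LinearMap.range (orbitMap π ξ) : Set H) := by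
      rintro _ ⟨b, rfl⟩
      exact ⟨a * b, by simp⟩
    exact this.closure (π a).continuous hx
  rcases hπ.2 _ (Submodule.isClosed_topologicalClosure _) hinv with h | h
  · -- The orbit of `ξ` vanishes, so that the line through `ξ` is invariant.
    exfalso
    have h0 : ∀ a, π a ξ = 0 := fun a => by
      have : π a ξ ∈ (LinearMap.range (orbitMap π ξ)).topologicalClosure :=
        Submodule.le_topologicalClosure _ ⟨a, rfl⟩
      rwa [h, Submodule.mem_bot] at this
    rcases hπ.2 (ℂ ∙ ξ) (Submodule.closed_of_finiteDimensional _) (by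
      intro a x hx
      obtain ⟨c, rfl⟩ := Submodule.mem_span_singleton.1 hx
      simp [h0 a]) with h' | h'
    · exact hξ (Submodule.span_singleton_eq_bot.1 h')
    · apply hπ.1
      ext a x
      obtain ⟨c, rfl⟩ := Submodule.mem_span_singleton.1 (h' ▸ Submodule.mem_top : x ∈ ℂ ∙ ξ)
      simp [h0 a]
  · rw [DenseRange, dense_iff_closure_eq]
    have := congrArg (fun V : Submodule ℂ H => (V : Set H)) h
    simpa [Submodule.topologicalClosure_coe] using! this

lemma IsIrreducible.exists_norm_eq_one (hπ : IsIrreducible π) : ∃ ξ : H, ‖ξ‖ = 1 := by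
  have : Nontrivial H := by
    by_contra h
    rw [not_nontrivial_iff_subsingleton] at h
    exact hπ.1 (by ext a x; exact Subsingleton.elim _ _)
  exact exists_norm_eq H zero_le_one

/-- Two representations are equivalent once both have dense equivariant images of `A` (as a left
module over itself) that induce the same seminorm on `A`. This contains the uniqueness of the GNS
representation, and avoids cyclic vectors. -/
lemma equivalent_of_norm_eq (V : A →ₗ[ℂ] H) (W : A →ₗ[ℂ] K) (hV : DenseRange V)
    (hW : DenseRange W) (hn : ∀ a, ‖V a‖ = ‖W a‖) (hπ : ∀ a b, π a (V b) = V (a * b))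
    (hσ : ∀ a b, σ a (W b) = W (a * b)) : Equivalent π σ := by
  have hn' : ∀ a, ‖W (LinearEquiv.refl ℂ A a)‖ = ‖V a‖ := fun a => (hn a).symm
  have key : ∀ b, (LinearEquiv.refl ℂ A).extendOfIsometry V W hV hW hn' (V b) = W b :=
    LinearEquiv.extendOfIsometry_eq _ V W hV hW hn'
  refine ⟨(LinearEquiv.refl ℂ A).extendOfIsometry V W hV hW hn', fun a x => ?_⟩
  refine hV.induction_on x (isClosed_eq (by fun_prop) (by fun_prop)) fun b => ?_
  rw [hπ, key, key, hσ]

/-- A seminorm comparison on `A` produces a bounded intertwiner. -/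
lemma exists_intertwiner (V : A →ₗ[ℂ] H) (W : A →ₗ[ℂ] K) (hV : DenseRange V) (C : ℝ)
    (hn : ∀ a, ‖W a‖ ≤ C * ‖V a‖) (hπ : ∀ a b, π a (V b) = V (a * b))
    (hσ : ∀ a b, σ a (W b) = W (a * b)) :
    ∃ T : H →L[ℂ] K, (∀ a, T (V a) = W a) ∧ ∀ a x, T (π a x) = σ a (T x) := by
  have key := LinearMap.extendOfNorm_eq (f := W) (e := V) hV ⟨C, hn⟩
  refine ⟨W.extendOfNorm V, key, fun a x => ?_⟩
  refine hV.induction_on x (isClosed_eq (by fun_prop) (by fun_prop)) fun b => ?_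
  rw [hπ, key, key, hσ]

/-- The adjoint of an intertwiner is an intertwiner. -/
lemma adjoint_intertwines {T : H →L[ℂ] K} (hT : ∀ a x, T (π a x) = σ a (T x)) (a : A) (y : K) :
    T.adjoint (σ a y) = π a (T.adjoint y) := by
  refine ext_inner_left ℂ fun x => ?_
  rw [ContinuousLinearMap.adjoint_inner_right, ← star_star a, inner_map_star, inner_map_star,
    ContinuousLinearMap.adjoint_inner_right, hT]

lemma Equivalent.symm (h : Equivalent π σ) : Equivalent σ π := by
  obtain ⟨U, hU⟩ := h
  exact ⟨U.symm, fun a x => by rw [LinearIsometryEquiv.symm_apply_eq, hU, U.apply_symm_apply]⟩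

lemma Equivalent.trans {L : Type*} [NormedAddCommGroup L] [InnerProductSpace ℂ L]
    [CompleteSpace L] {τ : A →⋆ₙₐ[ℂ] (L →L[ℂ] L)} (h : Equivalent π σ) (h' : Equivalent σ τ) :
    Equivalent π τ := by
  obtain ⟨U, hU⟩ := h
  obtain ⟨U', hU'⟩ := h'
  exact ⟨U.trans U', fun a x => by simp [hU, hU']⟩

/-- Disjointness depends only on the equivalence classes. -/
lemma DisjointRep.congr {H' K' : Type*} [NormedAddCommGroup H'] [InnerProductSpace ℂ H']
    [CompleteSpace H'] [NormedAddCommGroup K'] [InnerProductSpace ℂ K'] [CompleteSpace K']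
    {π' : A →⋆ₙₐ[ℂ] (H' →L[ℂ] H')} {σ' : A →⋆ₙₐ[ℂ] (K' →L[ℂ] K')}
    (h : DisjointRep π σ) (hπ : Equivalent π π') (hσ : Equivalent σ σ') : DisjointRep π' σ' := by
  obtain ⟨U, hU⟩ := hπ
  obtain ⟨V, hV⟩ := hσ.symm
  intro T hT
  have := h ((V : K' →L[ℂ] K) ∘L T ∘L (U : H →L[ℂ] H')) fun a x => by simp [hU, hT, hV]
  ext x
  have h0 := DFunLike.congr_fun this (U.symm x)
  simpa using h0

/-- **Schur's lemma** for self-adjoint operators. For real `s`, the positive and the negative part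
of `T - s` have product zero, and their kernels are invariant; so one of them vanishes, and the
spectrum of `T` lies on one side of `s`. -/
lemma IsIrreducible.exists_eq_smul_one (hπ : IsIrreducible π) {T : H →L[ℂ] H}
    (hT : IsSelfAdjoint T) (hcomm : ∀ a x, T (π a x) = π a (T x)) :
    ∃ c : ℝ, T = algebraMap ℝ (H →L[ℂ] H) c := by
  have : Nontrivial H := by
    obtain ⟨ξ, hξ⟩ := hπ.exists_norm_eq_one
    exact ⟨ξ, 0, by rintro rfl; simp at hξ⟩
  have hker : ∀ f : ℝ → ℝ, (cfc f T).ker = ⊥ ∨ (cfc f T).ker = ⊤ := by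
    intro f
    refine hπ.2 _ (cfc f T).isClosed_ker fun a x hx => ?_
    have hc : Commute T (π a) := by ext x; exact hcomm a x
    have := DFunLike.congr_fun (hc.cfc_real f).eq x
    simp only [mul_apply_eq_comp] at this
    change cfc f T x = 0 at hx
    change cfc f T (π a x) = 0
    rw [this, hx, map_zero]
  have hside : ∀ s : ℝ, (∀ t ∈ spectrum ℝ T, t ≤ s) ∨ (∀ t ∈ spectrum ℝ T, s ≤ t) := by
    intro s
    rcases hker (fun t => max (t - s) 0) with h | h
    · right
      have hprod : cfc (fun t : ℝ => max (t - s) 0) T * cfc (fun t : ℝ => max (s - t) 0) T = 0 := by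
        rw [← cfc_mul .., ← cfc_zero ℝ T]
        refine cfc_congr fun t _ => ?_
        rcases le_total t s with h' | h'
        · simp [max_eq_right (sub_nonpos.2 h')]
        · simp [max_eq_right (sub_nonpos.2 h')]
      have h0 : cfc (fun t : ℝ => max (s - t) 0) T = cfc (0 : ℝ → ℝ) T := by
        rw [cfc_zero ℝ T]
        ext x
        have := DFunLike.congr_fun hprod x
        rw [mul_apply_eq_comp] at this
        exact (LinearMap.ker_eq_bot'.1 h) _ this
      rw [cfc_eq_cfc_iff_eqOn] at h0
      intro t ht
      have := h0 ht
      simpa using this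
    · left
      have h0 : cfc (fun t : ℝ => max (t - s) 0) T = cfc (0 : ℝ → ℝ) T := by
        rw [cfc_zero ℝ T]
        ext x
        exact (h ▸ Submodule.mem_top : x ∈ (cfc (fun t : ℝ => max (t - s) 0) T).ker)
      rw [cfc_eq_cfc_iff_eqOn] at h0
      intro t ht
      have := h0 ht
      simpa using this
  obtain ⟨c, hc⟩ : (spectrum ℝ T).Nonempty :=
    ContinuousFunctionalCalculus.spectrum_nonempty T hT
  refine ⟨c, CFC.eq_algebraMap_of_spectrum_subset_singleton T c fun t ht => ?_⟩
  rw [Set.mem_singleton_iff]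
  by_contra hne
  rcases lt_or_gt_of_ne hne with hlt | hlt <;> rcases hside ((t + c) / 2) with h | h <;>
    linarith [h t ht, h c hc]

end Representations

/-! ### Vector states and their GNS representations -/

section VectorStates

open Filter CStarAlgebra

variable {A : Type u} [NonUnitalCStarAlgebra A]
variable {H : Type v} [NormedAddCommGroup H] [InnerProductSpace ℂ H] [CompleteSpace H]
variable {K : Type w} [NormedAddCommGroup K] [InnerProductSpace ℂ K] [CompleteSpace K]
variable {π : A →⋆ₙₐ[ℂ] (H →L[ℂ] H)} {σ : A →⋆ₙₐ[ℂ] (K →L[ℂ] K)}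

/-- The vector functional `a ↦ ⟪ξ, π a ξ⟫`. -/
def vecFunctional (π : A →⋆ₙₐ[ℂ] (H →L[ℂ] H)) (ξ : H) : A →L[ℂ] ℂ :=
  ((innerSL ℂ ξ).toLinearMap ∘ₗ orbitMap π ξ).mkContinuous (‖ξ‖ * ‖ξ‖) fun a => by
    refine (norm_inner_le_norm _ _).trans ?_
    have := mul_le_mul_of_nonneg_left (norm_map_apply_le π a ξ) (norm_nonneg ξ)
    simp only [orbitMap_apply]
    linarith

@[simp]
lemma vecFunctional_apply (π : A →⋆ₙₐ[ℂ] (H →L[ℂ] H)) (ξ : H) (a : A) :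
    vecFunctional π ξ a = inner ℂ ξ (π a ξ) := rfl

lemma norm_vecFunctional_le (π : A →⋆ₙₐ[ℂ] (H →L[ℂ] H)) {ξ : H} (hξ : ‖ξ‖ ≤ 1) :
    ‖vecFunctional π ξ‖ ≤ 1 :=
  (LinearMap.mkContinuous_norm_le _ (by positivity) _).trans
    (mul_le_one₀ hξ (norm_nonneg _) hξ)

variable [PartialOrder A] [StarOrderedRing A]

lemma vecFunctional_nonneg (π : A →⋆ₙₐ[ℂ] (H →L[ℂ] H)) (ξ : H) {a : A} (ha : 0 ≤ a) :
    0 ≤ vecFunctional π ξ a := by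
  obtain ⟨b, rfl⟩ := CStarAlgebra.nonneg_iff_eq_star_mul_self.1 ha
  rw [vecFunctional_apply, norm_map_apply_sq]
  positivity

/-- A functional that is nonnegative on nonnegative elements, as a positive linear map. -/
def posOfNonneg (f : A →L[ℂ] ℂ) (hf : ∀ a, 0 ≤ a → 0 ≤ f a) : A →ₚ[ℂ] ℂ :=
  PositiveLinearMap.mk₀ f.toLinearMap hf

@[simp]
lemma posOfNonneg_apply (f : A →L[ℂ] ℂ) (hf : ∀ a, 0 ≤ a → 0 ≤ f a) (a : A) :
    posOfNonneg f hf a = f a := rfl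

/-- The vector functional `a ↦ ⟪ξ, π a ξ⟫` as a positive linear map. -/
def vecState (π : A →⋆ₙₐ[ℂ] (H →L[ℂ] H)) (ξ : H) : A →ₚ[ℂ] ℂ :=
  posOfNonneg (vecFunctional π ξ) fun _ => vecFunctional_nonneg π ξ

@[simp]
lemma vecState_apply (π : A →⋆ₙₐ[ℂ] (H →L[ℂ] H)) (ξ : H) (a : A) :
    vecState π ξ a = inner ℂ ξ (π a ξ) := rfl

/-- The canonical map of `A` into the GNS space. -/
def toGNS (f : A →ₚ[ℂ] ℂ) : A →ₗ[ℂ] f.GNS where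
  toFun a := (f.toPreGNS a : f.GNS)
  map_add' a b := by rw [map_add, UniformSpace.Completion.coe_add]
  map_smul' c a := by rw [map_smul, UniformSpace.Completion.coe_smul]; rfl

lemma denseRange_toGNS (f : A →ₚ[ℂ] ℂ) : DenseRange (toGNS f) :=
  UniformSpace.Completion.denseRange_coe.comp f.toPreGNS.surjective.denseRange
    (UniformSpace.Completion.continuous_coe _)

lemma inner_toGNS (f : A →ₚ[ℂ] ℂ) (a b : A) :
    inner ℂ (toGNS f a) (toGNS f b) = f (star a * b) :=
  UniformSpace.Completion.inner_coe _ _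

lemma norm_toGNS_sq (f : A →ₚ[ℂ] ℂ) (a : A) : (‖toGNS f a‖ : ℂ) ^ 2 = f (star a * a) := by
  rw [← inner_toGNS, inner_self_eq_norm_sq_to_K]; rfl

lemma gns_toGNS (f : A →ₚ[ℂ] ℂ) (a b : A) :
    f.gnsNonUnitalStarAlgHom a (toGNS f b) = toGNS f (a * b) :=
  PositiveLinearMap.gnsNonUnitalStarAlgHom_apply_coe f

/-- The GNS representation of a vector state of an irreducible representation is that
representation. -/
lemma IsIrreducible.equivalent_gns (hπ : IsIrreducible π) {ξ : H} (hξ : ‖ξ‖ = 1) :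
    Equivalent (vecState π ξ).gnsNonUnitalStarAlgHom π := by
  refine equivalent_of_norm_eq (toGNS _) (orbitMap π ξ) (denseRange_toGNS _)
    (hπ.denseRange_orbitMap (by rintro rfl; simp at hξ)) (fun a => ?_) (gns_toGNS _)
    fun a b => by simp
  rw [← sq_eq_sq₀ (norm_nonneg _) (norm_nonneg _)]
  have h := norm_toGNS_sq (vecState π ξ) a
  rw [vecState_apply, norm_map_apply_sq] at h
  exact_mod_cast h

lemma IsIrreducible.tendsto_approximateUnit (hπ : IsIrreducible π) {ξ : H} (hξ : ξ ≠ 0) :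
    Tendsto (fun e => π e ξ) (approximateUnit A) (𝓝 ξ) := by
  have hu := increasingApproximateUnit (A := A)
  rw [Metric.tendsto_nhds]
  intro ε hε
  obtain ⟨_, hb, ⟨b, rfl⟩⟩ :=
    Metric.dense_iff.1 (hπ.denseRange_orbitMap hξ) ξ (ε / 3) (by positivity)
  rw [Metric.mem_ball, orbitMap_apply, dist_eq_norm] at hb
  have h1 : Tendsto (fun e => π (e * b) ξ) (approximateUnit A) (𝓝 (π b ξ)) :=
    (show Continuous fun a => π a ξ from
      ((orbitMap π ξ).mkContinuous ‖ξ‖ fun a => by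
        rw [mul_comm]; exact norm_map_apply_le π a ξ).continuous).continuousAt.tendsto.comp
      (hu.tendsto_mul_right b)
  rw [Metric.tendsto_nhds] at h1
  filter_upwards [h1 (ε / 3) (by positivity), hu.eventually_norm] with e he he1
  rw [dist_eq_norm] at he ⊢
  have h2 : ‖π e (π b ξ - ξ)‖ < ε / 3 :=
    ((norm_map_apply_le π e _).trans (mul_le_of_le_one_left (norm_nonneg _) he1)).trans_lt hb
  have h3 : π e ξ - ξ = -π e (π b ξ - ξ) + (π (e * b) ξ - π b ξ) + (π b ξ - ξ) := by
    rw [map_sub, map_mul, mul_apply_eq_comp]; abel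
  rw [h3]
  refine (norm_add₃_le ..).trans_lt ?_
  rw [norm_neg]
  linarith

lemma IsIrreducible.vecFunctional_mem_stateSpace (hπ : IsIrreducible π) {ξ : H} (hξ : ‖ξ‖ = 1) :
    vecFunctional π ξ ∈ stateSpace A := by
  refine ⟨fun _ => vecFunctional_nonneg π ξ, le_antisymm (norm_vecFunctional_le π hξ.le) ?_⟩
  have hu := increasingApproximateUnit (A := A)
  have h1 : Tendsto (fun e => ‖vecFunctional π ξ e‖) (approximateUnit A) (𝓝 1) := by
    have := (tendsto_const_nhds (x := ξ)).inner (𝕜 := ℂ)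
      (hπ.tendsto_approximateUnit (ξ := ξ) (by rintro rfl; simp at hξ))
    rw [inner_self_eq_norm_sq_to_K, hξ] at this
    simpa using this.norm
  refine le_of_tendsto h1 ?_
  filter_upwards [hu.eventually_norm] with e he
  exact ((vecFunctional π ξ).le_opNorm e).trans (mul_le_of_le_one_right (norm_nonneg _) he)

/-- Vector states of irreducible representations are pure. A state `g` dominated by a multiple of
the vector state `f` of `ξ` yields a bounded intertwiner `T` from the given representation to the
GNS representation of `g`; by Schur's lemma `T† T` is a scalar, so that `g` is a multiple
of `f`. -/
lemma IsIrreducible.isPureState_vecState (hπ : IsIrreducible π) {ξ : H} (hξ : ‖ξ‖ = 1) :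
    IsPureState (vecState π ξ) := by
  have hξ0 : ξ ≠ 0 := by rintro rfl; simp at hξ
  have hu := increasingApproximateUnit (A := A)
  refine ⟨vecFunctional π ξ, ?_, fun a => rfl⟩
  rw [mem_extremePoints_iff_left]
  refine ⟨hπ.vecFunctional_mem_stateSpace hξ, ?_⟩
  rintro g ⟨hg, hg1⟩ h ⟨hh, -⟩ ⟨s, t, hs, ht, hst, hf⟩
  have hV := hπ.denseRange_orbitMap hξ0
  have hdom : ∀ a, ‖toGNS (posOfNonneg g hg) a‖ ≤ √(s⁻¹) * ‖orbitMap π ξ a‖ := by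
    intro a
    rw [← sq_le_sq₀ (norm_nonneg _) (by positivity), mul_pow, Real.sq_sqrt (by positivity),
      inv_mul_eq_div, le_div_iff₀ hs, mul_comm, ← Complex.real_le_real]
    push_cast
    rw [norm_toGNS_sq, orbitMap_apply, ← norm_map_apply_sq, ← vecFunctional_apply, ← hf]
    simp only [posOfNonneg_apply, add_apply, smul_apply,
      Complex.real_smul]
    have h0 : 0 ≤ h (star a * a) := hh _ (star_mul_self_nonneg a)
    have ht' : (0 : ℂ) ≤ t := by exact_mod_cast ht.le
    exact le_add_of_nonneg_right (mul_nonneg ht' h0)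
  obtain ⟨T, hT, hTi⟩ := exists_intertwiner (π := π) (orbitMap π ξ) (toGNS (posOfNonneg g hg)) hV _
    hdom (fun a b => by simp) (gns_toGNS _)
  obtain ⟨c, hc⟩ := hπ.exists_eq_smul_one (T := T.adjoint ∘L T)
    (ContinuousLinearMap.isPositive_adjoint_comp_self T).isSelfAdjoint fun a x => by
      simp only [ContinuousLinearMap.comp_apply]
      rw [hTi, adjoint_intertwines hTi]
  have hc' : ∀ x, T.adjoint (T x) = (c : ℂ) • x := fun x => by
    have := DFunLike.congr_fun hc x
    simpa [Algebra.algebraMap_eq_smul_one] using! this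
  have hc0 : 0 ≤ c := by
    have h1 : inner ℂ ξ (T.adjoint (T ξ)) = (‖T ξ‖ : ℂ) ^ 2 := by
      rw [ContinuousLinearMap.adjoint_inner_right, inner_self_eq_norm_sq_to_K]; rfl
    rw [hc', inner_smul_right, inner_self_eq_norm_sq_to_K, hξ] at h1
    have h2 : c = ‖T ξ‖ ^ 2 := by
      simp only [Complex.coe_algebraMap, Complex.ofReal_one, one_pow, mul_one] at h1
      exact_mod_cast h1
    rw [h2]; positivity
  have hgf : ∀ a b, g (star a * b) = c * vecFunctional π ξ (star a * b) := by
    intro a b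
    have h1 := inner_toGNS (posOfNonneg g hg) a b
    rw [← hT, ← hT, ← ContinuousLinearMap.adjoint_inner_right, hc', inner_smul_right] at h1
    rw [vecFunctional_apply, inner_map_star_mul]
    exact h1.symm
  have hg' : g = (c : ℂ) • vecFunctional π ξ := by
    ext b
    have h1 := (g.continuous.tendsto b).comp (hu.tendsto_mul_right b)
    have h2 := (((c : ℂ) • vecFunctional π ξ).continuous.tendsto b).comp (hu.tendsto_mul_right b)
    refine tendsto_nhds_unique h1 (h2.congr fun e => ?_)
    have := hgf (star e) b
    rw [star_star] at this
    exact this.symm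
  have hc1 : c = 1 := by
    have := congrArg norm hg'
    rw [hg1, norm_smul, (hπ.vecFunctional_mem_stateSpace hξ).2, Complex.norm_real,
      Real.norm_of_nonneg hc0, mul_one] at this
    exact this.symm
  rw [hg', hc1, Complex.ofReal_one, one_smul]

end VectorStates

/-! ### Approximation of vector states -/

section Milman

variable {E : Type*} [AddCommGroup E] [Module ℝ E] [TopologicalSpace E] [IsTopologicalAddGroup E]
  [ContinuousSMul ℝ E]

lemma isCompact_convexJoin {s t : Set E} (hs : IsCompact s) (ht : IsCompact t) :
    IsCompact (convexJoin ℝ s t) := by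
  have h : convexJoin ℝ s t =
      (fun p : ℝ × E × E => AffineMap.lineMap (k := ℝ) p.2.1 p.2.2 p.1) ''
        (Set.Icc 0 1 ×ˢ s ×ˢ t) := by
    ext x
    simp only [mem_convexJoin, segment_eq_image_lineMap, Set.mem_image, Set.mem_prod, Prod.exists]
    constructor
    · rintro ⟨a, ha, b, hb, r, hr, rfl⟩
      exact ⟨r, a, b, ⟨hr, ha, hb⟩, rfl⟩
    · rintro ⟨r, a, b, ⟨hr, ha, hb⟩, rfl⟩
      exact ⟨a, ha, b, hb, r, hr, rfl⟩
  rw [h]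
  refine (isCompact_Icc.prod (hs.prod ht)).image ?_
  simp only [AffineMap.lineMap_apply_module]
  fun_prop

variable [T2Space E]

/-- An extreme point of a compact convex set that lies in the closed convex hull of a union of two
subsets lies in the closed convex hull of one of them. -/
lemma mem_closure_convexHull_or_of_mem_union {D X Y : Set E} {z : E} (hD : IsCompact D)
    (hDc : Convex ℝ D) (hX : X ⊆ D) (hY : Y ⊆ D) (hz : z ∈ D.extremePoints ℝ)
    (h : z ∈ closure (convexHull ℝ (X ∪ Y))) :
    z ∈ closure (convexHull ℝ X) ∨ z ∈ closure (convexHull ℝ Y) := by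
  rcases X.eq_empty_or_nonempty with rfl | hX0
  · right; simpa using h
  rcases Y.eq_empty_or_nonempty with rfl | hY0
  · left; simpa using h
  have hsub : ∀ {Z : Set E}, Z ⊆ D → closure (convexHull ℝ Z) ⊆ D := fun hZ =>
    closure_minimal (convexHull_min hZ hDc) hD.isClosed
  have hc : ∀ {Z : Set E}, Z ⊆ D → IsCompact (closure (convexHull ℝ Z)) := fun hZ =>
    hD.of_isClosed_subset isClosed_closure (hsub hZ)
  have hjoin : closure (convexHull ℝ (X ∪ Y)) ⊆
      convexJoin ℝ (closure (convexHull ℝ X)) (closure (convexHull ℝ Y)) := by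
    refine closure_minimal ?_ (isCompact_convexJoin (hc hX) (hc hY)).isClosed
    rw [convexHull_union hX0 hY0]
    exact convexJoin_mono subset_closure subset_closure
  obtain ⟨a, ha, b, hb, hab⟩ := mem_convexJoin.1 (hjoin h)
  rcases (mem_extremePoints_iff_forall_segment.1 hz).2 a (hsub hX ha) b (hsub hY hb) hab
    with rfl | rfl
  · exact Or.inl ha
  · exact Or.inr hb

/-- **Milman's converse to the Krein–Milman theorem**: an extreme point of a compact convex set that
lies in the closed convex hull of a subset `X` lies in the closure of `X`. -/
theorem mem_closure_of_mem_extremePoints [LocallyConvexSpace ℝ E] {D X : Set E} {z : E}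
    (hD : IsCompact D) (hDc : Convex ℝ D) (hX : X ⊆ D) (hz : z ∈ D.extremePoints ℝ)
    (h : z ∈ closure (convexHull ℝ X)) : z ∈ closure X := by
  by_contra hzX
  have hcX : IsCompact (closure X) :=
    hD.of_isClosed_subset isClosed_closure (closure_minimal hX hD.isClosed)
  -- Small pieces of `X` do not have `z` in their closed convex hull; this passes to finite unions.
  have key : z ∉ closure (convexHull ℝ (X ∩ closure X)) := by
    refine hcX.induction_on (p := fun s => z ∉ closure (convexHull ℝ (X ∩ s))) (by simp)
      (fun s t hst ht hs => ht (closure_mono (convexHull_mono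
        (Set.inter_subset_inter_right X hst)) hs)) (fun s t hs ht hst => ?_) fun x hx => ?_
    · rw [Set.inter_union_distrib_left] at hst
      rcases mem_closure_convexHull_or_of_mem_union hD hDc (Set.inter_subset_left.trans hX)
        (Set.inter_subset_left.trans hX) hz hst with h' | h'
      exacts [hs h', ht h']
    · have hxz : x ≠ z := by rintro rfl; exact hzX hx
      obtain ⟨U, V, hU, hV, hxU, hzV, hUV⟩ := t2_separation hxz
      obtain ⟨C, ⟨hC, hCc⟩, hCU⟩ :=
        (LocallyConvexSpace.convex_basis (𝕜 := ℝ) x).mem_iff.1 (hU.mem_nhds hxU)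
      refine ⟨C, mem_nhdsWithin_of_mem_nhds hC, fun hzC => ?_⟩
      obtain ⟨y, hyV, hyC⟩ := mem_closure_iff.1 hzC V hV hzV
      have hyC' : y ∈ C := convexHull_min Set.inter_subset_right hCc hyC
      exact Set.disjoint_left.1 hUV (hCU hyC') hyV
  rw [Set.inter_eq_left.2 subset_closure] at key
  exact key h

omit [ContinuousSMul ℝ E] in
/-- An extreme point of a compact convex set lies in the closure of a subset `X` as soon as no
continuous linear functional separates it from `X`. -/
theorem mem_closure_of_mem_extremePoints_of_re_le [LocallyConvexSpace ℝ E] [Module ℂ E]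
    [IsScalarTower ℝ ℂ E] [ContinuousSMul ℂ E] {D X : Set E} {z : E}
    (hD : IsCompact D) (hDc : Convex ℝ D) (hX : X ⊆ D) (hz : z ∈ D.extremePoints ℝ)
    (h : ∀ (F : StrongDual ℂ E) (u : ℝ), (∀ x ∈ X, (F x).re < u) → (F z).re ≤ u) :
    z ∈ closure X := by
  have := IsScalarTower.continuousSMul (M := ℝ) (α := E) ℂ
  refine mem_closure_of_mem_extremePoints hD hDc hX hz ?_
  by_contra hnot
  obtain ⟨F, u, hF, hu⟩ := RCLike.geometric_hahn_banach_closed_point (𝕜 := ℂ)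
    (convex_convexHull ℝ X).closure isClosed_closure hnot
  exact (h F u fun x hx => hF x (subset_closure (subset_convexHull ℝ X hx))).not_gt hu

end Milman

section Approximation

variable {A : Type u} [NonUnitalCStarAlgebra A]
variable {H : Type v} [NormedAddCommGroup H] [InnerProductSpace ℂ H] [CompleteSpace H]
variable {K : Type w} [NormedAddCommGroup K] [InnerProductSpace ℂ K] [CompleteSpace K]
variable {π : A →⋆ₙₐ[ℂ] (H →L[ℂ] H)} {ρ : A →⋆ₙₐ[ℂ] (K →L[ℂ] K)}

omit [CompleteSpace H] in
lemma algebraMap_sub_reApplyInnerSelf (T : H →L[ℂ] H) (c : ℝ) (x : H) :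
    (algebraMap ℝ (H →L[ℂ] H) c - T).reApplyInnerSelf x = c * ‖x‖ ^ 2 - (inner ℂ x (T x)).re := by
  have h1 : (algebraMap ℝ (H →L[ℂ] H) c - T) x = (c : ℂ) • x - T x := by
    rw [Algebra.algebraMap_eq_smul_one]; rfl
  have h2 : (inner ℂ (T x) x).re = (inner ℂ x (T x)).re := inner_re_symm (𝕜 := ℂ) (T x) x
  rw [ContinuousLinearMap.reApplyInnerSelf_apply, h1, inner_sub_left, inner_smul_left,
    inner_self_eq_norm_sq_to_K]
  simp [h2, ← Complex.ofReal_pow]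

lemma le_algebraMap_iff_re_inner_le {T : H →L[ℂ] H} (hT : IsSelfAdjoint T) {c : ℝ} :
    T ≤ algebraMap ℝ (H →L[ℂ] H) c ↔ ∀ x, (inner ℂ x (T x)).re ≤ c * ‖x‖ ^ 2 := by
  have hsa : IsSelfAdjoint (algebraMap ℝ (H →L[ℂ] H) c - T) :=
    (IsSelfAdjoint.algebraMap _ (IsSelfAdjoint.all c)).sub hT
  rw [ContinuousLinearMap.le_def, ContinuousLinearMap.isPositive_def', and_iff_right hsa]
  simp only [algebraMap_sub_reApplyInnerSelf, sub_nonneg]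

/-- If the kernel of `ρ` lies in the kernel of `π`, then an upper bound for the quadratic forms of
`ρ h` is one for those of `π h`: apply the functional calculus to `t ↦ max (t - c) 0`, which
vanishes at `0` as `c ≥ 0`. -/
lemma re_inner_le_of_ker_le (hker : ∀ a, ρ a = 0 → π a = 0) {h : A} (hh : IsSelfAdjoint h) {c : ℝ}
    (hc : 0 ≤ c) (hρ : ∀ y, (inner ℂ y (ρ h y)).re ≤ c * ‖y‖ ^ 2) (x : H) :
    (inner ℂ x (π h x)).re ≤ c * ‖x‖ ^ 2 := by
  have hf0 : max ((0 : ℝ) - c) 0 = 0 := by simpa using hc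
  have hsρ : IsSelfAdjoint (ρ h) := hh.map ρ
  have hsπ : IsSelfAdjoint (π h) := hh.map π
  have hρc : Continuous ρ := AddMonoidHomClass.continuous_of_bound ρ 1 fun a => by
    simpa using NonUnitalStarAlgHom.norm_apply_le ρ a
  have hπc : Continuous π := AddMonoidHomClass.continuous_of_bound π 1 fun a => by
    simpa using NonUnitalStarAlgHom.norm_apply_le π a
  rw [← le_algebraMap_iff_re_inner_le hsρ, le_algebraMap_iff_spectrum_le] at hρ
  have h1 : ρ (cfcₙ (fun t : ℝ => max (t - c) 0) h) = 0 := by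
    rw [NonUnitalStarAlgHom.map_cfcₙ ρ _ h (hφ := hρc), ← cfcₙ_zero ℝ (ρ h)]
    refine cfcₙ_congr fun t ht => ?_
    rw [quasispectrum_eq_spectrum_union_zero] at ht
    rcases ht with ht | rfl
    · simpa using hρ t ht
    · exact hf0
  have h2 := hker _ h1
  rw [NonUnitalStarAlgHom.map_cfcₙ π _ h (hφ := hπc), ← cfcₙ_zero ℝ (π h),
    cfcₙ_eq_cfcₙ_iff_eqOn] at h2
  refine (le_algebraMap_iff_re_inner_le hsπ).1 ((le_algebraMap_iff_spectrum_le hsπ).2 ?_) x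
  intro t ht
  have := h2 (spectrum_subset_quasispectrum ℝ _ ht)
  simpa using this

lemma re_inner_add_star (π : A →⋆ₙₐ[ℂ] (H →L[ℂ] H)) (a : A) (x : H) :
    (inner ℂ x (π (a + star a) x)).re = 2 * (inner ℂ x (π a x)).re := by
  rw [map_add, add_apply, inner_add_right, inner_map_star, Complex.add_re,
    ← inner_conj_symm (π a x) x, Complex.conj_re]
  ring

variable [PartialOrder A]

variable (A) in
/-- The quasi-state space in the weak* topology: the positive functionals of norm at most one. -/
def quasiStateSpace : Set (WeakDual ℂ A) :=
  {f | (∀ a : A, 0 ≤ a → 0 ≤ f a) ∧ ‖WeakDual.toStrongDual f‖ ≤ 1}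

lemma isCompact_quasiStateSpace : IsCompact (quasiStateSpace A) := by
  have h : quasiStateSpace A = (WeakDual.toStrongDual ⁻¹' Metric.closedBall 0 1) ∩
      ⋂ a : A, ⋂ _ : 0 ≤ a, {f | 0 ≤ f a} := by
    ext f
    simp [quasiStateSpace, and_comm]
  rw [h]
  refine (WeakDual.isCompact_closedBall 0 1).inter_right ?_
  exact isClosed_iInter fun a => isClosed_iInter fun _ =>
    isClosed_le continuous_const (WeakDual.eval_continuous a)

lemma convex_quasiStateSpace : Convex ℝ (quasiStateSpace A) := by
  rintro f ⟨hf, hf1⟩ g ⟨hg, hg1⟩ s t hs ht hst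
  refine ⟨fun a ha => ?_, ?_⟩
  · change 0 ≤ (s : ℂ) • f a + (t : ℂ) • g a
    have hs' : (0 : ℂ) ≤ s := by exact_mod_cast hs
    have ht' : (0 : ℂ) ≤ t := by exact_mod_cast ht
    exact add_nonneg (mul_nonneg hs' (hf a ha)) (mul_nonneg ht' (hg a ha))
  · change ‖s • WeakDual.toStrongDual f + t • WeakDual.toStrongDual g‖ ≤ 1
    refine (norm_add_le _ _).trans ?_
    rw [norm_smul, norm_smul, Real.norm_of_nonneg hs, Real.norm_of_nonneg ht]
    nlinarith

/-- Extreme points of the state space are extreme among the quasi-states: if a state is a proper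
convex combination of quasi-states, these have norm one. -/
lemma mem_extremePoints_quasiStateSpace {f : A →L[ℂ] ℂ}
    (hf : f ∈ (stateSpace A).extremePoints ℝ) :
    StrongDual.toWeakDual f ∈ (quasiStateSpace A).extremePoints ℝ := by
  rw [mem_extremePoints_iff_left] at hf ⊢
  refine ⟨⟨hf.1.1, hf.1.2.le⟩, ?_⟩
  rintro g ⟨hg, hg1⟩ h ⟨hh, hh1⟩ ⟨s, t, hs, ht, hst, hsum⟩
  set g' : A →L[ℂ] ℂ := WeakDual.toStrongDual g with hg'
  set h' : A →L[ℂ] ℂ := WeakDual.toStrongDual h with hh'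
  have hsum' : s • g' + t • h' = f := hsum
  have hn : 1 ≤ s * ‖g'‖ + t * ‖h'‖ := by
    have := norm_add_le (s • g') (t • h')
    rwa [hsum', hf.1.2, norm_smul, norm_smul, Real.norm_of_nonneg hs.le,
      Real.norm_of_nonneg ht.le] at this
  have h1 : ‖g'‖ = 1 := by
    refine le_antisymm hg1 ?_
    by_contra hlt
    nlinarith
  have h2 : ‖h'‖ = 1 := by
    refine le_antisymm hh1 ?_
    by_contra hlt
    nlinarith
  exact hf.2 g' ⟨hg, h1⟩ h' ⟨hh, h2⟩ ⟨s, t, hs, ht, hst, hsum'⟩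

variable [StarOrderedRing A]

/-- If the kernel of `ρ` lies in the kernel of `π`, then every pure vector state of `π` is a weak*
limit of vector functionals of `ρ`. By the Hahn–Banach theorem it lies in their closed convex hull,
and Milman's theorem does the rest. -/
lemma vecFunctional_mem_closure (hker : ∀ a, ρ a = 0 → π a = 0) {ξ : H} (hξ : ‖ξ‖ = 1)
    (hpure : vecFunctional π ξ ∈ (stateSpace A).extremePoints ℝ) :
    StrongDual.toWeakDual (vecFunctional π ξ) ∈
      closure ((fun η => StrongDual.toWeakDual (vecFunctional ρ η)) '' Metric.closedBall (0 : K) 1)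
    := by
  have : IsScalarTower ℝ ℂ (WeakDual ℂ A) := inferInstanceAs (IsScalarTower ℝ ℂ (A →L[ℂ] ℂ))
  have : LocallyConvexSpace ℝ (WeakDual ℂ A) :=
    inferInstanceAs (LocallyConvexSpace ℝ (WeakBilin (topDualPairing ℂ A)))
  refine mem_closure_of_mem_extremePoints_of_re_le (E := WeakDual ℂ A) isCompact_quasiStateSpace
    convex_quasiStateSpace ?_ (mem_extremePoints_quasiStateSpace hpure) fun F u hF => ?_
  · rintro _ ⟨η, hη, rfl⟩
    exact ⟨fun a => vecFunctional_nonneg ρ η, norm_vecFunctional_le ρ (by simpa using hη)⟩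
  obtain ⟨a, rfl⟩ := LinearMap.dualEmbedding_surjective (topDualPairing ℂ A) F
  have hρ : ∀ η : K, ‖η‖ ≤ 1 → (inner ℂ η (ρ a η)).re < u := fun η hη =>
    hF _ ⟨η, by simpa using hη, rfl⟩
  change (inner ℂ ξ (π a ξ)).re ≤ u
  have hu0 : 0 < u := by simpa using hρ 0 (by simp)
  have := re_inner_le_of_ker_le hker (IsSelfAdjoint.add_star_self a) (c := 2 * u) (by positivity)
    (fun η => ?_) ξ
  · rw [re_inner_add_star, hξ] at this
    linarith
  · rw [re_inner_add_star]
    rcases eq_or_ne η 0 with rfl | hη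
    · simp
    have hn : 0 < ‖η‖ := norm_pos_iff.2 hη
    have h1 := hρ ((‖η‖⁻¹ : ℂ) • η) (by rw [norm_smul]; simp [hn.ne'])
    have h2 : (inner ℂ ((‖η‖⁻¹ : ℂ) • η) (ρ a ((‖η‖⁻¹ : ℂ) • η))).re =
        (‖η‖ ^ 2)⁻¹ * (inner ℂ η (ρ a η)).re := by
      rw [map_smul, inner_smul_left, inner_smul_right, ← Complex.ofReal_inv, Complex.conj_ofReal,
        Complex.re_ofReal_mul, Complex.re_ofReal_mul]
      ring
    rw [h2, inv_mul_lt_iff₀ (by positivity)] at h1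
    nlinarith

/-- Vector states of an irreducible representation `π` are approximated, on finite sets, by vector
states of every representation `ρ` with `ker ρ ⊆ ker π`. -/
lemma IsIrreducible.exists_vecState_close (hπ : IsIrreducible π) (hker : ∀ a, ρ a = 0 → π a = 0)
    {ξ : H} (hξ : ‖ξ‖ = 1) (G : Finset A) {δ : ℝ} (hδ : 0 < δ) :
    ∃ η : K, ‖η‖ = 1 ∧ ∀ x ∈ G, ‖vecState ρ η x - vecState π ξ x‖ < δ := by
  have hu := CStarAlgebra.increasingApproximateUnit (A := A)
  have hξ0 : ξ ≠ 0 := by rintro rfl; simp at hξ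
  set M : ℝ := ∑ x ∈ G, ‖x‖
  have hM : ∀ x ∈ G, ‖x‖ ≤ M := fun x hx =>
    Finset.single_le_sum (f := fun x => ‖x‖) (fun _ _ => norm_nonneg _) hx
  have hM0 : 0 ≤ M := Finset.sum_nonneg fun _ _ => norm_nonneg _
  obtain ⟨κ, hκ, hκ1, hκδ⟩ : ∃ κ : ℝ, 0 < κ ∧ κ ≤ 1 / 4 ∧ κ * (1 + 2 * M) ≤ δ :=
    ⟨min (1 / 4) (δ / (1 + 2 * M)), by positivity, min_le_left _ _,
      (le_div_iff₀ (by positivity)).1 (min_le_right _ _)⟩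
  -- An element of the unit ball at which the given state is almost one keeps the approximating
  -- vectors away from zero.
  obtain ⟨e, he, he1⟩ : ∃ e : A, ‖e‖ ≤ 1 ∧ ‖inner ℂ ξ (π e ξ) - 1‖ < κ := by
    have h1 := (tendsto_const_nhds (x := ξ)).inner (𝕜 := ℂ) (hπ.tendsto_approximateUnit hξ0)
    rw [inner_self_eq_norm_sq_to_K, hξ] at h1
    have h2 : Filter.Tendsto (fun e => ‖inner ℂ ξ (π e ξ) - 1‖) (CStarAlgebra.approximateUnit A)
        (𝓝 0) := by
      simpa using (h1.sub_const 1).norm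
    obtain ⟨e, h3, h4⟩ := (hu.eventually_norm.and (h2.eventually_lt_const hκ)).exists
    exact ⟨e, h3, h4⟩
  obtain ⟨f, hf, hfpure⟩ := hπ.isPureState_vecState hξ
  have hfξ : ∃ f ∈ (stateSpace A).extremePoints ℝ, vecFunctional π ξ = f :=
    ⟨_, hf, by ext a; exact (hfpure a).symm⟩
  obtain ⟨_, hpure, rfl⟩ := hfξ
  have hcl := vecFunctional_mem_closure hker hξ hpure
  have hopen : IsOpen (⋂ x ∈ insert e (G : Set A),
      {g : WeakDual ℂ A | ‖g x - vecFunctional π ξ x‖ < κ}) :=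
    (G.finite_toSet.insert e).isOpen_biInter fun x _ =>
      isOpen_lt ((WeakDual.eval_continuous x).sub continuous_const).norm continuous_const
  obtain ⟨_, hmem, η, hη, rfl⟩ := mem_closure_iff.1 hcl _ hopen
    (Set.mem_iInter₂.2 fun x _ => by
      change ‖vecFunctional π ξ x - vecFunctional π ξ x‖ < κ
      simpa using hκ)
  have hclose : ∀ x ∈ insert e (G : Set A), ‖inner ℂ η (ρ x η) - inner ℂ ξ (π x ξ)‖ < κ :=
    fun x hx => Set.mem_iInter₂.1 hmem x hx
  have hη1 : ‖η‖ ≤ 1 := by simpa using hη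
  have hη2 : 1 - 2 * κ < ‖η‖ ^ 2 := by
    have h1 := hclose e (Set.mem_insert _ _)
    have h2 : ‖inner ℂ η (ρ e η)‖ ≤ ‖η‖ ^ 2 := by
      refine (norm_inner_le_norm _ _).trans ?_
      have := (norm_map_apply_le ρ e η).trans (mul_le_of_le_one_left (norm_nonneg _) he)
      nlinarith [norm_nonneg η]
    have h3 : ‖(1 : ℂ)‖ ≤ ‖inner ℂ η (ρ e η)‖ + ‖inner ℂ η (ρ e η) - inner ℂ ξ (π e ξ)‖ +
        ‖inner ℂ ξ (π e ξ) - 1‖ := by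
      have h4 : (1 : ℂ) = inner ℂ η (ρ e η) - (inner ℂ η (ρ e η) - inner ℂ ξ (π e ξ)) -
        (inner ℂ ξ (π e ξ) - 1) := by ring
      conv_lhs => rw [h4]
      exact (norm_sub_le _ _).trans (add_le_add_left (norm_sub_le _ _) _)
    rw [norm_one] at h3
    linarith
  have hn : 0 < ‖η‖ := by
    by_contra h0
    have : ‖η‖ = 0 := le_antisymm (not_lt.1 h0) (norm_nonneg _)
    rw [this] at hη2
    linarith
  have hunit : ‖(‖η‖⁻¹ : ℂ) • η‖ = 1 := by rw [norm_smul]; simp [hn.ne']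
  refine ⟨(‖η‖⁻¹ : ℂ) • η, hunit, fun x hx => ?_⟩
  have h1 := hclose x (Set.mem_insert_of_mem _ hx)
  have h2 : inner ℂ η (ρ x η) = (‖η‖ : ℂ) ^ 2 * vecState ρ ((‖η‖⁻¹ : ℂ) • η) x := by
    have hc : (‖η‖ : ℂ) ≠ 0 := by exact_mod_cast hn.ne'
    rw [vecState_apply, map_smul, inner_smul_left, inner_smul_right, ← Complex.ofReal_inv,
      Complex.conj_ofReal, Complex.ofReal_inv]
    field_simp
  have h3 : ‖vecState ρ ((‖η‖⁻¹ : ℂ) • η) x‖ ≤ M := by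
    refine (((vecFunctional ρ ((‖η‖⁻¹ : ℂ) • η)).le_opNorm x).trans ?_).trans (hM x hx)
    exact mul_le_of_le_one_left (norm_nonneg _) (norm_vecFunctional_le ρ hunit.le)
  set z := vecState ρ ((‖η‖⁻¹ : ℂ) • η) x
  have h4 : z - vecState π ξ x = (inner ℂ η (ρ x η) - inner ℂ ξ (π x ξ)) +
      ((1 - ‖η‖ ^ 2 : ℝ) : ℂ) * z := by
    rw [h2, vecState_apply]; push_cast; ring
  have h5 : ‖((1 - ‖η‖ ^ 2 : ℝ) : ℂ) * z‖ ≤ 2 * κ * M := by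
    rw [norm_mul, Complex.norm_real, Real.norm_of_nonneg (by nlinarith)]
    exact mul_le_mul (by linarith) h3 (norm_nonneg _) (by positivity)
  rw [h4]
  refine (norm_add_le _ _).trans_lt ?_
  nlinarith

end Approximation

/-! ### Inner automorphisms and their limits -/

section Limits

open Filter

variable {A : Type u} [NonUnitalCStarAlgebra A]

/-- `Ad u` as a `*`-homomorphism. -/
def adHom (u : unitaryGroup A) : A →⋆ₙₐ[ℂ] A where
  toFun := Ad u
  map_smul' c x := Unitization.inr_injective (R := ℂ) <| by
    simp [inr_Ad, Unitization.inr_smul]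
  map_zero' := Unitization.inr_injective (R := ℂ) <| by simp [inr_Ad]
  map_add' x y := Unitization.inr_injective (R := ℂ) <| by
    simp [inr_Ad, Unitization.inr_add, mul_add, add_mul]
  map_mul' x y := Unitization.inr_injective (R := ℂ) <| by
    have h : star (u : Unitization ℂ A) * u = 1 := Unitary.coe_star_mul_self u.1
    simp only [inr_Ad, Unitization.inr_mul]
    calc (u : Unitization ℂ A) * (x * y) * star (u : Unitization ℂ A)
        = u * x * 1 * y * star (u : Unitization ℂ A) := by simp only [mul_assoc, one_mul]
      _ = _ := by rw [← h]; simp only [mul_assoc]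
  map_star' x := Unitization.inr_injective (R := ℂ) <| by
    simp [inr_Ad, Unitization.inr_star, mul_assoc]

@[simp]
lemma adHom_apply (u : unitaryGroup A) (x : A) : adHom u x = Ad u x := rfl

lemma Ad_mul (u v : unitaryGroup A) (x : A) : Ad (u * v) x = Ad u (Ad v x) :=
  Unitization.inr_injective (R := ℂ) <| by simp [inr_Ad, mul_assoc]

@[simp]
lemma Ad_one (x : A) : Ad (1 : unitaryGroup A) x = x :=
  Unitization.inr_injective (R := ℂ) <| by simp [inr_Ad]

@[simp]
lemma Ad_inv_Ad (u : unitaryGroup A) (x : A) : Ad u⁻¹ (Ad u x) = x := by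
  rw [← Ad_mul, inv_mul_cancel, Ad_one]

@[simp]
lemma Ad_Ad_inv (u : unitaryGroup A) (x : A) : Ad u (Ad u⁻¹ x) = x := by
  rw [← Ad_mul, mul_inv_cancel, Ad_one]

lemma Ad_sub (u : unitaryGroup A) (x y : A) : Ad u (x - y) = Ad u x - Ad u y :=
  map_sub (adHom u) x y

@[simp]
lemma norm_Ad (u : unitaryGroup A) (x : A) : ‖Ad u x‖ = ‖x‖ := by
  have h : ∀ (v : unitaryGroup A) (y : A), ‖Ad v y‖ ≤ ‖y‖ := fun v y =>
    NonUnitalStarAlgHom.norm_apply_le (adHom v) y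
  exact le_antisymm (h u x) (by simpa using h u⁻¹ (Ad u x))

/-- Pointwise convergence of inner automorphisms to an isometric map needs to be checked on a dense
set only. -/
lemma tendsto_Ad_of_dense {ι : Type*} {l : Filter ι} {u : ι → unitaryGroup A} {E : A → A}
    (hE : ∀ x y, ‖E x - E y‖ ≤ ‖x - y‖) {D : Set A} (hD : Dense D)
    (h : ∀ x ∈ D, Tendsto (fun i => Ad (u i) x) l (𝓝 (E x))) (x : A) :
    Tendsto (fun i => Ad (u i) x) l (𝓝 (E x)) := by
  rw [Metric.tendsto_nhds]
  intro ε hε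
  obtain ⟨y, hy, hyD⟩ := Metric.dense_iff.1 hD x (ε / 3) (by positivity)
  rw [Metric.mem_ball, dist_eq_norm] at hy
  filter_upwards [Metric.tendsto_nhds.1 (h y hyD) (ε / 3) (by positivity)] with i hi
  rw [dist_eq_norm] at hi ⊢
  have h1 : ‖Ad (u i) x - Ad (u i) y‖ = ‖y - x‖ := by rw [← Ad_sub, norm_Ad, norm_sub_rev]
  have h2 := hE y x
  have h3 : Ad (u i) x - E x = (Ad (u i) x - Ad (u i) y) + (Ad (u i) y - E y) + (E y - E x) := by
    abel
  rw [h3]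
  refine (norm_add₃_le ..).trans_lt ?_
  linarith

/-- A sequence of inner automorphisms whose increments at the `i`-th member of a dense sequence are
eventually dominated by `2 ^ (-m)` converges pointwise to a `*`-homomorphism. -/
lemma exists_tendsto_Ad (P : ℕ → unitaryGroup A) {x : ℕ → A} (hx : DenseRange x)
    (h : ∀ m, ∀ i ≤ m, ‖Ad (P (m + 1)) (x i) - Ad (P m) (x i)‖ ≤ (1 / 2) ^ m) :
    ∃ φ : A →⋆ₙₐ[ℂ] A, ∀ y, Tendsto (fun m => Ad (P m) y) atTop (𝓝 (φ y)) := by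
  have hc : ∀ y, CauchySeq fun m => Ad (P m) y := by
    intro y
    rw [Metric.cauchySeq_iff']
    intro ε hε
    obtain ⟨_, hz, ⟨i, rfl⟩⟩ := Metric.dense_iff.1 hx y (ε / 3) (by positivity)
    rw [Metric.mem_ball, dist_eq_norm] at hz
    have hs : CauchySeq fun m => Ad (P m) (x i) := by
      refine cauchySeq_of_summable_dist (Summable.of_norm_bounded_eventually_nat
        summable_geometric_two ?_)
      filter_upwards [eventually_ge_atTop i] with m hm
      rw [Real.norm_of_nonneg dist_nonneg, dist_comm, dist_eq_norm]
      exact h m i hm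
    obtain ⟨N, hN⟩ := Metric.cauchySeq_iff'.1 hs (ε / 3) (by positivity)
    refine ⟨N, fun n hn => ?_⟩
    have h1 := hN n hn
    rw [dist_eq_norm] at h1 ⊢
    have h2 : ∀ m, ‖Ad (P m) y - Ad (P m) (x i)‖ = ‖x i - y‖ := fun m => by
      rw [← Ad_sub, norm_Ad, norm_sub_rev]
    have h3 : Ad (P n) y - Ad (P N) y = (Ad (P n) y - Ad (P n) (x i)) +
        (Ad (P n) (x i) - Ad (P N) (x i)) - (Ad (P N) y - Ad (P N) (x i)) := by abel
    rw [h3]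
    refine ((norm_sub_le _ _).trans (add_le_add_left (norm_add_le _ _) _)).trans_lt ?_
    rw [h2, h2]
    linarith
  choose φ hφ using fun y => cauchySeq_tendsto_of_complete (hc y)
  refine ⟨{ toFun := φ
            map_smul' := fun c y => tendsto_nhds_unique (hφ (c • y)) ?_
            map_zero' := tendsto_nhds_unique (hφ 0) ?_
            map_add' := fun y z => tendsto_nhds_unique (hφ (y + z)) ?_
            map_mul' := fun y z => tendsto_nhds_unique (hφ (y * z)) ?_
            map_star' := fun y => tendsto_nhds_unique (hφ (star y)) ?_ }, hφ⟩
  · exact ((hφ y).const_smul c).congr fun m => (map_smul (adHom (P m)) c y).symm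
  · exact tendsto_const_nhds.congr fun m => (map_zero (adHom (P m))).symm
  · exact ((hφ y).add (hφ z)).congr fun m => (map_add (adHom (P m)) y z).symm
  · exact ((hφ y).mul (hφ z)).congr fun m => (map_mul (adHom (P m)) y z).symm
  · exact (hφ y).star.congr fun m => (map_star (adHom (P m)) y).symm

/-- If both the inner automorphisms `Ad (P m)` and their inverses converge pointwise, then they
converge to an automorphism and to its inverse. -/
lemma exists_starAlgEquiv_tendsto_Ad (P : ℕ → unitaryGroup A) {x : ℕ → A} (hx : DenseRange x)
    (h : ∀ m, ∀ i ≤ m, ‖Ad (P (m + 1)) (x i) - Ad (P m) (x i)‖ ≤ (1 / 2) ^ m)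
    (h' : ∀ m, ∀ i ≤ m, ‖Ad (P (m + 1))⁻¹ (x i) - Ad (P m)⁻¹ (x i)‖ ≤ (1 / 2) ^ m) :
    ∃ E : A ≃⋆ₐ[ℂ] A, (∀ y, Tendsto (fun m => Ad (P m) y) atTop (𝓝 (E y))) ∧
      ∀ y, Tendsto (fun m => Ad (P m)⁻¹ y) atTop (𝓝 (E.symm y)) := by
  obtain ⟨φ, hφ⟩ := exists_tendsto_Ad P hx h
  obtain ⟨ψ, hψ⟩ := exists_tendsto_Ad (fun m => (P m)⁻¹) hx h'
  have h1 : ∀ y, ψ (φ y) = y := fun y => by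
    refine tendsto_nhds_unique (hψ (φ y)) ?_
    rw [tendsto_iff_norm_sub_tendsto_zero]
    refine (tendsto_iff_norm_sub_tendsto_zero.1 (hφ y)).congr fun m => ?_
    rw [← norm_Ad (P m)⁻¹, Ad_sub, Ad_inv_Ad, norm_sub_rev]
  have h2 : ∀ y, φ (ψ y) = y := fun y => by
    refine tendsto_nhds_unique (hφ (ψ y)) ?_
    rw [tendsto_iff_norm_sub_tendsto_zero]
    refine (tendsto_iff_norm_sub_tendsto_zero.1 (hψ y)).congr fun m => ?_
    rw [← norm_Ad (P m), Ad_sub, Ad_Ad_inv, norm_sub_rev]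
  refine ⟨{ φ with
            invFun := ψ
            left_inv := h1
            right_inv := h2
            map_smul' := fun c y => map_smul φ c y }, hφ, hψ⟩

end Limits

/-! ### Infinite products of unitary paths -/

section Paths

open Filter unitInterval

variable {A : Type u} [NonUnitalCStarAlgebra A]

/-- The path that runs through `p 0, …, p (N - 1)` in turn during the unit intervals `[m, m + 1]`,
`m < N`, each path being multiplied from the left onto what has been reached, and that is constant
before and after. -/
def pathProd (p : ℕ → C(I, unitaryGroup A)) : ℕ → ℝ → unitaryGroup A
  | 0, _ => 1
  | N + 1, t => p N (Set.projIcc 0 1 zero_le_one (t - N)) * pathProd p N t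

lemma continuous_pathProd (p : ℕ → C(I, unitaryGroup A)) (N : ℕ) : Continuous (pathProd p N) := by
  induction N with
  | zero => exact continuous_const
  | succ N ih =>
    exact ((p N).continuous.comp (continuous_projIcc.comp (continuous_id.sub continuous_const))).mul
      ih

variable {p : ℕ → C(I, unitaryGroup A)}

lemma pathProd_eq_of_le (hp : ∀ m, p m 0 = 1) {M N : ℕ} (hMN : M ≤ N) {t : ℝ} (ht : t ≤ M) :
    pathProd p N t = pathProd p M t := by
  induction N, hMN using Nat.le_induction with
  | base => rfl
  | succ N hN ih =>
    have h1 : t - N ≤ 0 := by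
      have : (M : ℝ) ≤ N := by exact_mod_cast hN
      linarith
    have h2 : p N (Set.projIcc 0 1 zero_le_one (t - N)) = 1 := by
      rw [Set.projIcc_of_le_left _ h1]; exact hp N
    rw [pathProd, h2, one_mul, ih]

lemma pathProd_eq_of_ge {P : ℕ → unitaryGroup A} (hP0 : P 0 = 1)
    (hP : ∀ m, P (m + 1) = p m 1 * P m) (N : ℕ) {t : ℝ} (ht : (N : ℝ) ≤ t) :
    pathProd p N t = P N := by
  induction N with
  | zero => rw [hP0]; rfl
  | succ N ih =>
    push_cast at ht
    have h2 : p N (Set.projIcc 0 1 zero_le_one (t - N)) = p N 1 := by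
      rw [Set.projIcc_of_right_le _ (by linarith)]; rfl
    rw [pathProd, h2, ih (by linarith), hP]

/-- An infinite product of unitary paths starting at `1` that nearly fix longer and longer parts of
a dense sequence, and of its images under the partial products, converges: the resulting path of
inner automorphisms tends pointwise to an automorphism. -/
lemma exists_tendsto_Ad_path {x : ℕ → A} (hx : DenseRange x) (hp : ∀ m, p m 0 = 1)
    {P : ℕ → unitaryGroup A} (hP0 : P 0 = 1) (hP : ∀ m, P (m + 1) = p m 1 * P m)
    (h : ∀ m t, ∀ i ≤ m, ‖Ad (p m t) (x i) - x i‖ ≤ (1 / 2) ^ m)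
    (h' : ∀ m t, ∀ i ≤ m, ‖Ad (p m t) (Ad (P m) (x i)) - Ad (P m) (x i)‖ ≤ (1 / 2) ^ m) :
    ∃ (E : A ≃⋆ₐ[ℂ] A) (w : ℝ → unitaryGroup A), Continuous w ∧
      (∀ y, Tendsto (fun t => Ad (w t) y) atTop (𝓝 (E y))) ∧
      ∀ y, Tendsto (fun m => Ad (P m)⁻¹ y) atTop (𝓝 (E.symm y)) := by
  obtain ⟨E, hE, hE'⟩ := exists_starAlgEquiv_tendsto_Ad P hx
    (fun m i hi => by rw [hP, Ad_mul]; exact h' m 1 i hi)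
    (fun m i hi => by
      rw [hP, mul_inv_rev, Ad_mul, ← Ad_sub, norm_Ad, ← norm_Ad (p m 1), Ad_sub, Ad_Ad_inv,
        norm_sub_rev]
      exact h m 1 i hi)
  have hw : ∀ {N : ℕ} {t : ℝ}, t ≤ N → pathProd p ⌈t⌉₊ t = pathProd p N t := fun ht =>
    (pathProd_eq_of_le hp (Nat.ceil_le.2 ht) (Nat.le_ceil _)).symm
  refine ⟨E, fun t => pathProd p ⌈t⌉₊ t, ?_, ?_, hE'⟩
  · -- Locally, the infinite product is a finite one.
    rw [continuous_iff_continuousAt]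
    intro t
    refine (continuous_pathProd p (⌈t⌉₊ + 1)).continuousAt.congr ?_
    have : t < (⌈t⌉₊ + 1 : ℕ) := by push_cast; linarith [Nat.le_ceil t]
    filter_upwards [Iio_mem_nhds this] with s hs
    exact (hw (le_of_lt hs)).symm
  · refine tendsto_Ad_of_dense (fun y z => ?_) hx ?_
    · rw [← map_sub]
      exact NonUnitalStarAlgHom.norm_apply_le (E : A →⋆ₙₐ[ℂ] A) (y - z)
    rintro _ ⟨i, rfl⟩
    have hlim : Tendsto (fun t : ℝ => Ad (P ⌊t⌋₊) (x i)) atTop (𝓝 (E (x i))) :=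
      (hE (x i)).comp tendsto_nat_floor_atTop
    refine hlim.congr_dist ?_
    have hz : Tendsto (fun t : ℝ => (1 / 2 : ℝ) ^ ⌊t⌋₊) atTop (𝓝 0) :=
      (tendsto_pow_atTop_nhds_zero_of_lt_one (by norm_num) (by norm_num)).comp
        tendsto_nat_floor_atTop
    refine squeeze_zero' (Eventually.of_forall fun _ => dist_nonneg) ?_ hz
    filter_upwards [eventually_ge_atTop (i : ℝ), eventually_ge_atTop (0 : ℝ)] with t ht ht0
    have h1 : (⌊t⌋₊ : ℝ) ≤ t := Nat.floor_le ht0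
    have h2 : t ≤ (⌊t⌋₊ + 1 : ℕ) := by push_cast; exact (Nat.lt_floor_add_one t).le
    rw [hw h2, pathProd, pathProd_eq_of_ge hP0 hP _ h1, Ad_mul, dist_comm, dist_eq_norm]
    exact h' _ _ i (Nat.le_floor ht)

/-- If `E` and `O` are limits of continuous paths of inner automorphisms, then `O⁻¹ ∘ E` is
asymptotically inner. -/
lemma isAsymptoticallyInner_trans_symm {E O : A ≃⋆ₐ[ℂ] A} {v w : ℝ → unitaryGroup A}
    (hv : Continuous v) (hw : Continuous w)
    (hE : ∀ y, Tendsto (fun t => Ad (v t) y) atTop (𝓝 (E y)))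
    (hO : ∀ y, Tendsto (fun t => Ad (w t) y) atTop (𝓝 (O y))) :
    IsAsymptoticallyInner (E.trans O.symm) := by
  have hlim : ∀ y, Tendsto (fun t => Ad ((w t)⁻¹ * v t) y) atTop (𝓝 (E.trans O.symm y)) := by
    intro y
    rw [tendsto_iff_norm_sub_tendsto_zero]
    have h1 := tendsto_iff_norm_sub_tendsto_zero.1 (hE y)
    have h2 := tendsto_iff_norm_sub_tendsto_zero.1 (hO (O.symm (E y)))
    rw [O.apply_symm_apply] at h2
    refine squeeze_zero (fun _ => norm_nonneg _) (fun t => ?_) (by simpa using h1.add h2)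
    change ‖_ - O.symm (E y)‖ ≤ _
    rw [← norm_Ad (w t), Ad_sub, Ad_mul, Ad_Ad_inv, norm_sub_rev (Ad (w t) _)]
    exact norm_sub_le_norm_sub_add_norm_sub _ _ _
  have hs : Tendsto (fun t : ℝ => t / (1 - t)) (𝓝[<] 1) atTop := by
    have h1 : Tendsto (fun t : ℝ => 1 - t) (𝓝[<] 1) (𝓝[>] 0) := by
      refine tendsto_nhdsWithin_iff.2 ⟨?_, ?_⟩
      · have : Tendsto (fun t : ℝ => 1 - t) (𝓝 1) (𝓝 (1 - 1)) := tendsto_const_nhds.sub tendsto_id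
        rw [sub_self] at this
        exact this.mono_left nhdsWithin_le_nhds
      · filter_upwards [self_mem_nhdsWithin] with t ht
        exact sub_pos.2 (Set.mem_Iio.1 ht)
    have h2 : Tendsto (fun t : ℝ => t) (𝓝[<] 1) (𝓝 1) := tendsto_id.mono_left nhdsWithin_le_nhds
    simpa [div_eq_mul_inv] using h2.pos_mul_atTop one_pos (tendsto_inv_nhdsGT_zero.comp h1)
  have hlim' : ∀ y, Tendsto (fun t : ℝ => Ad ((w (t / (1 - t)))⁻¹ * v (t / (1 - t))) y) (𝓝[<] 1)
      (𝓝 (E.trans O.symm y)) := fun y => (hlim y).comp hs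
  refine ⟨fun F ε hε => ?_, fun t => (w (t / (1 - t)))⁻¹ * v (t / (1 - t)), ?_, hlim'⟩
  · have : ∀ᶠ t in atTop, ∀ y ∈ F, ‖Ad ((w t)⁻¹ * v t) y - E.trans O.symm y‖ < ε := by
      rw [Finset.eventually_all]
      exact fun y _ => (tendsto_iff_norm_sub_tendsto_zero.1 (hlim y)).eventually_lt_const hε
    obtain ⟨t, ht⟩ := this.exists
    exact ⟨_, ht⟩
  · have hc : ContinuousOn (fun t : ℝ => t / (1 - t)) (Set.Ico 0 1) :=
      continuousOn_id.div (by fun_prop) fun t ht => (sub_pos.2 ht.2).ne'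
    exact (hw.comp_continuousOn hc).inv.mul (hv.comp_continuousOn hc)

end Paths

/-! ### The back-and-forth construction -/

section BackAndForth

open Filter unitInterval

variable {A : Type u} [NonUnitalCStarAlgebra A] [PartialOrder A] [StarOrderedRing A]

/-- A sequence of nonempty sets of pure states is a *sector sequence* if the states in each set are
mutually equivalent and states from different sets are disjoint. -/
structure IsSectorSeq (S : ℕ → Set (A →ₚ[ℂ] ℂ)) : Prop where
  nonempty : ∀ i, (S i).Nonempty
  pure : ∀ i, ∀ ω ∈ S i, IsPureState ω
  equivalent : ∀ i, ∀ ω ∈ S i, ∀ φ ∈ S i, EquivalentStates ω φ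
  disjoint : ∀ i j, i ≠ j → ∀ ω ∈ S i, ∀ φ ∈ S j, DisjointStates ω φ

/-- Each state in `S i` is approximated, on finite sets, by states in `T i`. -/
def IsApproximatedBy (S T : ℕ → Set (A →ₚ[ℂ] ℂ)) : Prop :=
  ∀ i, ∀ ω ∈ S i, ∀ (G : Finset A) (δ : ℝ), 0 < δ → ∃ φ ∈ T i, ∀ x ∈ G, ‖φ x - ω x‖ < δ

/-- Finite families of equivalent pure states of `A` that are `δ`-close on `G` are transported into
each other along a path of unitaries that moves the elements of `F` by less than `ε`. -/
def Transports (F : Finset A) (ε : ℝ) (G : Finset A) (δ : ℝ) : Prop :=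
  ∀ (n : ℕ) (ω φ : Fin n → (A →ₚ[ℂ] ℂ)),
    (∀ i, IsPureState (ω i)) → (∀ i, IsPureState (φ i)) →
    (Pairwise fun i j => DisjointStates (ω i) (ω j)) →
    (∀ i, EquivalentStates (ω i) (φ i)) →
    (∀ i, ∀ x ∈ G, ‖ω i x - φ i x‖ < δ) →
    ∃ p : C(I, unitaryGroup A), p 0 = 1 ∧ (∀ i, ∀ b : A, ω i b = φ i (Ad (p 1) b)) ∧
      ∀ t, ∀ x ∈ F, ‖Ad (p t) x - x‖ < ε

lemma StrongTransitivityProperty.exists_transports (hA : StrongTransitivityProperty A)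
    (F : Finset A) {ε : ℝ} (hε : 0 < ε) : ∃ G δ, 0 < δ ∧ Transports F ε G δ := by
  obtain ⟨G, δ, hδ, h⟩ := hA F ε hε
  exact ⟨G, δ, hδ, fun n ω φ => h A (NonUnitalStarAlgHom.id ℂ A) Function.injective_id n ω φ⟩

variable (A) in
/-- The data at one stage of the back-and-forth construction: the current family of states and the
next one, which belongs to the opposite side; the products of the unitaries found so far on either
side; and the finite set and the tolerance governing the approximation of the one family by the
other. -/
structure Stage where
  /-- The current family of states. -/
  cur : ℕ → (A →ₚ[ℂ] ℂ)
  /-- The family of states on the opposite side, approximating the current one. -/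
  next : ℕ → (A →ₚ[ℂ] ℂ)
  /-- The product of the unitaries on the current side. -/
  curProd : unitaryGroup A
  /-- The product of the unitaries on the opposite side. -/
  nextProd : unitaryGroup A
  /-- The finite set on which the families agree approximately. -/
  set : Finset A
  /-- Twice the accuracy of the approximation. -/
  tol : ℝ

/-- The elements to be nearly fixed at stage `k`: an initial part of the sequence `x`, together with
its image under `Ad W`. Fixing the former makes the inverses of the partial products converge,
fixing the latter the partial products themselves. -/
def fixedSet (x : ℕ → A) (W : unitaryGroup A) (k : ℕ) : Finset A :=
  open Classical in
  (Finset.range (k + 1)).image x ∪ (Finset.range (k + 1)).image fun i => Ad W (x i)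

/-- The requirements on stage `k`; `R k` is the sector sequence of the current side. -/
structure Stage.IsValid (R : ℕ → ℕ → Set (A →ₚ[ℂ] ℂ)) (x : ℕ → A) (k : ℕ) (s : Stage A) :
    Prop where
  cur_mem : ∀ i, s.cur i ∈ R k i
  next_mem : ∀ i, s.next i ∈ R (k + 1) i
  close : ∀ i, ∀ y ∈ s.set, ‖s.next i y - s.cur i y‖ < s.tol / 2
  transports : Transports (fixedSet x s.curProd k) ((1 / 2) ^ k) s.set s.tol
  mem_set : ∀ i ≤ k, x i ∈ s.set
  tol_pos : 0 < s.tol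
  tol_le : s.tol ≤ (1 / 2) ^ k

/-- The relation between stages `k` and `k + 1`, through the path `p` found in between. -/
structure Stage.Follows (x : ℕ → A) (k : ℕ) (s s' : Stage A) (p : C(I, unitaryGroup A)) : Prop where
  cur_eq : s'.cur = s.next
  curProd_eq : s'.curProd = s.nextProd
  nextProd_eq : s'.nextProd = p 1 * s.curProd
  map_zero : p 0 = 1
  near : ∀ t, ∀ y ∈ fixedSet x s.curProd k, ‖Ad (p t) y - y‖ < (1 / 2) ^ k
  apply_eq : ∀ i < k, ∀ y, s.cur i y = s'.next i (Ad (p 1) y)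

variable {R : ℕ → ℕ → Set (A →ₚ[ℂ] ℂ)}

/-- Given a family of states and the product of the unitaries on its side, the family on the
opposite side and the tolerances can be chosen, so that the previous requirements of closeness
continue to hold. -/
lemma exists_tolerance_and_next (hA : StrongTransitivityProperty A)
    (happ : ∀ k, IsApproximatedBy (R k) (R (k + 1))) (x : ℕ → A) (k : ℕ)
    {θ : ℕ → (A →ₚ[ℂ] ℂ)} (hθ : ∀ i, θ i ∈ R k i) (W : unitaryGroup A) (G₀ : Finset A) {δ₀ : ℝ}
    (hδ₀ : 0 < δ₀) :
    ∃ (G : Finset A) (δ : ℝ) (θ' : ℕ → (A →ₚ[ℂ] ℂ)), G₀ ⊆ G ∧ δ ≤ δ₀ ∧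
      ∀ W', Stage.IsValid R x k ⟨θ, θ', W, W', G, δ⟩ := by
  classical
  obtain ⟨G₁, δ₁, hδ₁, h⟩ := hA.exists_transports (fixedSet x W k) (ε := (1 / 2) ^ k)
    (by positivity)
  set G := G₁ ∪ G₀ ∪ (Finset.range (k + 1)).image x
  set δ := min δ₁ (min δ₀ ((1 / 2) ^ k))
  have hδ : 0 < δ := lt_min hδ₁ (lt_min hδ₀ (by positivity))
  choose θ' hθ' hclose using fun i => happ k i (θ i) (hθ i) G (δ / 2) (by positivity)
  refine ⟨G, δ, θ', fun y hy => by simp [G, hy], (min_le_right _ _).trans (min_le_left _ _),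
    fun W' => ⟨hθ, hθ', hclose, ?_, fun i hi => ?_, hδ,
      (min_le_right _ _).trans (min_le_right _ _)⟩⟩
  · intro n ω φ hω hφ hd he hc
    exact h n ω φ hω hφ hd he fun i y hy =>
      (hc i y (by simp [G, hy])).trans_le (min_le_left _ _)
  · refine Finset.mem_union_right _ (Finset.mem_image_of_mem x ?_)
    simpa using Nat.lt_succ_of_le hi

lemma Stage.IsValid.exists_follows (hA : StrongTransitivityProperty A)
    (hR : ∀ k, IsSectorSeq (R k)) (hper : ∀ k, R (k + 2) = R k)
    (happ : ∀ k, IsApproximatedBy (R k) (R (k + 1))) {x : ℕ → A} {k : ℕ} {s : Stage A}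
    (hs : s.IsValid R x k) :
    ∃ s' : Stage A, s'.IsValid R x (k + 1) ∧ ∃ p, s.Follows x k s' p := by
  obtain ⟨G, δ, θ', hG, hδ, hvalid⟩ := exists_tolerance_and_next hA happ x (k + 1) hs.next_mem
    s.nextProd s.set hs.tol_pos
  have hθ' : ∀ i, θ' i ∈ R k i := fun i => hper k ▸ (hvalid 1).next_mem i
  obtain ⟨p, hp0, hp1, hp⟩ := hs.transports k (fun i => s.cur i) (fun i => θ' i)
    (fun i => (hR k).pure _ _ (hs.cur_mem i)) (fun i => (hR k).pure _ _ (hθ' i))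
    (fun i j hij => (hR k).disjoint i j (fun h => hij (Fin.ext h)) _ (hs.cur_mem i) _
      (hs.cur_mem j))
    (fun i => (hR k).equivalent i _ (hs.cur_mem i) _ (hθ' i))
    (fun i y hy => by
      have h1 := hs.close i y hy
      have h2 : ‖θ' i y - s.next i y‖ < δ / 2 := (hvalid 1).close i y (hG hy)
      have h3 : s.cur i y - θ' i y = -((s.next i y - s.cur i y) + (θ' i y - s.next i y)) := by ring
      rw [h3, norm_neg]
      exact (norm_add_le _ _).trans_lt (by linarith))
  exact ⟨_, hvalid (p 1 * s.curProd), p, rfl, rfl, rfl, hp0, hp,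
    fun i hi y => hp1 ⟨i, hi⟩ y⟩

lemma exists_stages (hA : StrongTransitivityProperty A)
    (hR : ∀ k, IsSectorSeq (R k)) (hper : ∀ k, R (k + 2) = R k)
    (happ : ∀ k, IsApproximatedBy (R k) (R (k + 1))) (x : ℕ → A) :
    ∃ (s : ℕ → Stage A) (p : ℕ → C(I, unitaryGroup A)), (∀ k, (s k).IsValid R x k) ∧
      (∀ k, (s k).Follows x k (s (k + 1)) (p k)) ∧ (s 0).curProd = 1 ∧ (s 0).nextProd = 1 := by
  choose θ hθ using (hR 0).nonempty
  obtain ⟨G, δ, θ', -, -, hvalid⟩ := exists_tolerance_and_next hA happ x 0 hθ 1 ∅ one_pos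
  have step : ∀ k (s : Stage A), ∃ s' : Stage A, s.IsValid R x k →
      s'.IsValid R x (k + 1) ∧ ∃ p, s.Follows x k s' p := fun k s => by
    by_cases hs : s.IsValid R x k
    · obtain ⟨s', h⟩ := hs.exists_follows hA hR hper happ
      exact ⟨s', fun _ => h⟩
    · exact ⟨s, fun h => absurd h hs⟩
  choose f hf using step
  let s : ℕ → Stage A := fun n => Nat.rec ⟨θ, θ', 1, 1, G, δ⟩ f n
  have hs : ∀ k, (s k).IsValid R x k := fun k => by
    induction k with
    | zero => exact hvalid 1
    | succ k ih => exact (hf k _ ih).1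
  choose p hp using fun k => (hf k _ (hs k)).2
  exact ⟨s, p, hs, hp, rfl, rfl⟩

omit [StarOrderedRing A] in
/-- States that are transported into one another by the factors of a convergent infinite product
converge pointwise. -/
lemma tendsto_of_transported {θ : ℕ → (A →ₚ[ℂ] ℂ)} {P U : ℕ → unitaryGroup A} {E : A ≃⋆ₐ[ℂ] A}
    {M : ℕ} (hpure : IsPureState (θ M)) (hP : ∀ m, P (m + 1) = U m * P m)
    (hθ : ∀ m, M ≤ m → ∀ y, θ m y = θ (m + 1) (Ad (U m) y))
    (hE : ∀ y, Tendsto (fun m => Ad (P m)⁻¹ y) atTop (𝓝 (E.symm y))) (y : A) :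
    Tendsto (fun m => θ m y) atTop (𝓝 (θ M (Ad (P M) (E.symm y)))) := by
  have h1 : ∀ m, M ≤ m → ∀ y, θ m (Ad (P m) y) = θ M (Ad (P M) y) := by
    intro m hm
    induction m, hm using Nat.le_induction with
    | base => exact fun _ => rfl
    | succ m hm ih => exact fun y => by rw [hP, Ad_mul, ← hθ m hm, ih]
  obtain ⟨f, -, hf⟩ := hpure
  have hc : Continuous fun y => θ M (Ad (P M) y) := by
    have h2 : Continuous fun y => f (Ad (P M) y) := f.continuous.comp <|
      AddMonoidHomClass.continuous_of_bound (adHom (P M)) 1 fun a => by simp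
    exact h2.congr fun y => hf _
  refine ((hc.tendsto _).comp (hE y)).congr' ?_
  filter_upwards [eventually_ge_atTop M] with m hm
  rw [Function.comp_apply, ← h1 m hm, Ad_Ad_inv]

/-- **Back and forth.** If the members of two sector sequences approximate each other, then an
asymptotically inner automorphism matches them, up to inner automorphisms. -/
theorem exists_isAsymptoticallyInner_of_isApproximatedBy [TopologicalSpace.SeparableSpace A]
    (hA : StrongTransitivityProperty A) {S T : ℕ → Set (A →ₚ[ℂ] ℂ)} (hS : IsSectorSeq S)
    (hT : IsSectorSeq T) (hST : IsApproximatedBy S T) (hTS : IsApproximatedBy T S) :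
    ∃ α : A ≃⋆ₐ[ℂ] A, IsAsymptoticallyInner α ∧ ∀ i, ∃ ω ∈ S i, ∃ φ ∈ T i,
      ∃ u v : unitaryGroup A, ∀ y, ω (Ad u y) = φ (Ad v (α y)) := by
  classical
  let R : ℕ → ℕ → Set (A →ₚ[ℂ] ℂ) := fun k => if Even k then S else T
  have hReven : ∀ m, R (2 * m) = S := fun m => if_pos (even_two_mul m)
  have hRodd : ∀ m, R (2 * m + 1) = T := fun m => if_neg (by simp)
  have hR : ∀ k, IsSectorSeq (R k) := fun k => by
    rcases Nat.even_or_odd' k with ⟨m, rfl | rfl⟩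
    · rwa [hReven]
    · rwa [hRodd]
  have hper : ∀ k, R (k + 2) = R k := fun k => by simp [R, Nat.even_add]
  have happ : ∀ k, IsApproximatedBy (R k) (R (k + 1)) := fun k => by
    rcases Nat.even_or_odd' k with ⟨m, rfl | rfl⟩
    · rwa [hReven, hRodd]
    · rwa [hRodd, show 2 * m + 1 + 1 = 2 * (m + 1) by ring, hReven]
  obtain ⟨x, hx⟩ := TopologicalSpace.exists_dense_seq A
  obtain ⟨s, p, hs, hp, h0, h1⟩ := exists_stages hA hR hper happ x
  have hW : ∀ k, (s (k + 2)).curProd = p k 1 * (s k).curProd := fun k => by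
    rw [(hp (k + 1)).curProd_eq, (hp k).nextProd_eq]
  have hθ : ∀ k, ∀ i < k, ∀ y, (s k).cur i y = (s (k + 2)).cur i (Ad (p k 1) y) :=
    fun k i hi y => by rw [(hp (k + 1)).cur_eq]; exact (hp k).apply_eq i hi y
  have hpow : ∀ {m k : ℕ}, m ≤ k → ((1 : ℝ) / 2) ^ k ≤ (1 / 2) ^ m := fun h =>
    pow_le_pow_of_le_one (by norm_num) (by norm_num) h
  have hfix : ∀ {m k : ℕ}, m ≤ k → ∀ t, ∀ i ≤ m, ‖Ad (p k t) (x i) - x i‖ ≤ (1 / 2) ^ m := by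
    intro m k hmk t i hi
    refine ((hp k).near t _ ?_).le.trans (hpow hmk)
    refine Finset.mem_union_left _ (Finset.mem_image_of_mem x ?_)
    simpa using Nat.lt_succ_of_le (hi.trans hmk)
  have hfix' : ∀ {m k : ℕ}, m ≤ k → ∀ t, ∀ i ≤ m,
      ‖Ad (p k t) (Ad (s k).curProd (x i)) - Ad (s k).curProd (x i)‖ ≤ (1 / 2) ^ m := by
    intro m k hmk t i hi
    refine ((hp k).near t _ ?_).le.trans (hpow hmk)
    refine Finset.mem_union_right _ (Finset.mem_image.2 ⟨i, ?_, rfl⟩)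
    simpa using Nat.lt_succ_of_le (hi.trans hmk)
  obtain ⟨E, v, hv, hE, hE'⟩ := exists_tendsto_Ad_path (p := fun m => p (2 * m))
    (P := fun m => (s (2 * m)).curProd) hx (fun m => (hp _).map_zero) h0 (fun m => hW (2 * m))
    (fun m => hfix (by omega)) (fun m => hfix' (by omega))
  obtain ⟨O, w, hw, hO, hO'⟩ := exists_tendsto_Ad_path (p := fun m => p (2 * m + 1))
    (P := fun m => (s (2 * m + 1)).curProd) hx (fun m => (hp _).map_zero)
    ((hp 0).curProd_eq.trans h1) (fun m => hW (2 * m + 1))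
    (fun m => hfix (by omega)) (fun m => hfix' (by omega))
  refine ⟨E.trans O.symm, isAsymptoticallyInner_trans_symm hv hw hE hO, fun i => ?_⟩
  have hmem : ∀ k, (s k).cur i ∈ R k i := fun k => (hs k).cur_mem i
  have hpure : ∀ k, IsPureState ((s k).cur i) := fun k => (hR k).pure i _ (hmem k)
  have hl := tendsto_of_transported (θ := fun m => (s (2 * m)).cur i) (M := i + 1) (hpure _)
    (fun m => hW (2 * m)) (fun m hm => hθ (2 * m) i (by omega)) hE'
  have hl' := tendsto_of_transported (θ := fun m => (s (2 * m + 1)).cur i) (M := i + 1) (hpure _)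
    (fun m => hW (2 * m + 1)) (fun m hm => hθ (2 * m + 1) i (by omega)) hO'
  refine ⟨_, hReven (i + 1) ▸ hmem (2 * (i + 1)), _, hRodd (i + 1) ▸ hmem (2 * (i + 1) + 1),
    (s (2 * (i + 1))).curProd, (s (2 * (i + 1) + 1)).curProd, fun y => ?_⟩
  -- The two limit states agree on the dense sequence, hence everywhere.
  have hdense : ∀ z, (s (2 * (i + 1))).cur i (Ad (s (2 * (i + 1))).curProd (E.symm z)) =
      (s (2 * (i + 1) + 1)).cur i (Ad (s (2 * (i + 1) + 1)).curProd (O.symm z)) := by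
    have hcont : ∀ (k : ℕ) (W : unitaryGroup A) (B : A ≃⋆ₐ[ℂ] A),
        Continuous fun z => (s k).cur i (Ad W (B z)) := by
      intro k W B
      obtain ⟨f, -, hf⟩ := hpure k
      have hB : Continuous (B : A →⋆ₙₐ[ℂ] A) :=
        AddMonoidHomClass.continuous_of_bound (B : A →⋆ₙₐ[ℂ] A) 1 fun a => by
          simpa using NonUnitalStarAlgHom.norm_apply_le (B : A →⋆ₙₐ[ℂ] A) a
      have hAd : Continuous (adHom W) :=
        AddMonoidHomClass.continuous_of_bound (adHom W) 1 fun a => by simp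
      exact (f.continuous.comp (hAd.comp hB)).congr fun z => hf _
    refine fun z => congrFun (hx.equalizer (hcont _ _ E.symm) (hcont _ _ O.symm)
      (funext fun j => ?_)) z
    refine tendsto_nhds_unique (hl (x j)) ((hl' (x j)).congr_dist ?_)
    have hz : Tendsto (fun m : ℕ => (1 / 2 : ℝ) ^ m) atTop (𝓝 0) :=
      tendsto_pow_atTop_nhds_zero_of_lt_one (by norm_num) (by norm_num)
    refine squeeze_zero' (Eventually.of_forall fun _ => dist_nonneg) ?_ hz
    filter_upwards [eventually_ge_atTop j] with m hm
    have h2 := (hs (2 * m)).close i (x j) ((hs (2 * m)).mem_set j (by omega))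
    rw [(hp (2 * m)).cur_eq, dist_eq_norm]
    have h3 := (hs (2 * m)).tol_le
    have h4 := (hs (2 * m)).tol_pos
    have h5 : ((1 : ℝ) / 2) ^ (2 * m) ≤ (1 / 2) ^ m := hpow (by omega)
    linarith
  have := hdense (E y)
  rwa [E.symm_apply_apply] at this

end BackAndForth

/-! ### Equivalence of representations from matching vector states -/

section Matching

variable {A : Type u} [NonUnitalCStarAlgebra A]
variable {H : Type v} [NormedAddCommGroup H] [InnerProductSpace ℂ H] [CompleteSpace H]
variable {K : Type w} [NormedAddCommGroup K] [InnerProductSpace ℂ K] [CompleteSpace K]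
variable {π : A →⋆ₙₐ[ℂ] (H →L[ℂ] H)} {ρ : A →⋆ₙₐ[ℂ] (K →L[ℂ] K)}

/-- Right multiplication by an element of the unitization, as a map of the ideal `A` to itself. -/
def mulRight (z : Unitization ℂ A) : A →ₗ[ℂ] A where
  toFun a := ((a : Unitization ℂ A) * z).snd
  map_add' a b := by simp [add_mul]
  map_smul' c a := by simp

lemma inr_mulRight (z : Unitization ℂ A) (a : A) :
    ((mulRight z a : A) : Unitization ℂ A) = a * z := by
  ext <;> simp [mulRight]

lemma mul_mulRight (z : Unitization ℂ A) (a b : A) : b * mulRight z a = mulRight z (b * a) :=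
  Unitization.inr_injective (R := ℂ) <| by
    simp only [Unitization.inr_mul, inr_mulRight, mul_assoc]

lemma mulRight_star_surjective (u : unitaryGroup A) :
    Function.Surjective (mulRight (star (u : Unitization ℂ A))) := fun a => by
  have h : (u : Unitization ℂ A) * star (u : Unitization ℂ A) = 1 := Unitary.coe_mul_star_self u.1
  exact ⟨mulRight u a, Unitization.inr_injective (R := ℂ) <| by
    rw [inr_mulRight, inr_mulRight, mul_assoc, h, mul_one]⟩

lemma star_mulRight_mul_mulRight (u : unitaryGroup A) (a : A) :
    star (mulRight (star (u : Unitization ℂ A)) a) * mulRight (star (u : Unitization ℂ A)) a =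
      Ad u (star a * a) :=
  Unitization.inr_injective (R := ℂ) <| by
    simp only [inr_Ad, Unitization.inr_mul, Unitization.inr_star, inr_mulRight, star_mul, star_star,
      mul_assoc]

lemma IsIrreducible.denseRange_orbitMap_comp (hπ : IsIrreducible π) {ξ : H} (hξ : ξ ≠ 0)
    {g : A → A} (hg : Function.Surjective g) : DenseRange (orbitMap π ξ ∘ g) := by
  rw [DenseRange, hg.range_comp]
  exact hπ.denseRange_orbitMap hξ

variable [PartialOrder A] [StarOrderedRing A]

lemma norm_map_mulRight_apply_sq (π : A →⋆ₙₐ[ℂ] (H →L[ℂ] H)) (ξ : H) (u : unitaryGroup A) (a : A) :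
    (‖π (mulRight (star (u : Unitization ℂ A)) a) ξ‖ : ℂ) ^ 2 =
      vecState π ξ (Ad u (star a * a)) := by
  rw [← star_mulRight_mul_mulRight, vecState_apply, norm_map_apply_sq]

/-- If vector states of `π` and `ρ` are matched by `α`, up to inner automorphisms, then `π` is
equivalent to `ρ ∘ α`. -/
lemma IsIrreducible.equivalent_comp (hπ : IsIrreducible π) (hρ : IsIrreducible ρ) {ξ : H} {η : K}
    (hξ : ξ ≠ 0) (hη : η ≠ 0) (α : A ≃⋆ₐ[ℂ] A) (u v : unitaryGroup A)
    (h : ∀ a, vecState π ξ (Ad u a) = vecState ρ η (Ad v (α a))) :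
    Equivalent π (ρ.comp (α : A →⋆ₙₐ[ℂ] A)) := by
  -- Since `π` is not defined on `u`, the map `a ↦ π (a u*) ξ` replaces the orbit map of `π (u*) ξ`.
  refine equivalent_of_norm_eq
    (orbitMap π ξ ∘ₗ mulRight (star (u : Unitization ℂ A)))
    (orbitMap ρ η ∘ₗ mulRight (star (v : Unitization ℂ A)) ∘ₗ
      ((α : A →⋆ₙₐ[ℂ] A) : A →ₗ[ℂ] A)) ?_ ?_ (fun a => ?_) (fun a b => ?_) fun a b => ?_
  · exact hπ.denseRange_orbitMap_comp hξ (mulRight_star_surjective u)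
  · exact hρ.denseRange_orbitMap_comp hη ((mulRight_star_surjective v).comp α.surjective)
  · rw [← sq_eq_sq₀ (norm_nonneg _) (norm_nonneg _), ← Complex.ofReal_inj]
    push_cast
    refine (norm_map_mulRight_apply_sq π ξ u a).trans (((h _).trans ?_).trans
      (norm_map_mulRight_apply_sq ρ η v (α a)).symm)
    rw [map_mul, map_star]
  · change π a (π _ ξ) = π _ ξ
    rw [← mul_apply_eq_comp, ← map_mul, mul_mulRight]
  · change ρ (α a) (ρ (mulRight _ (α b)) η) = ρ (mulRight _ (α (a * b))) η
    rw [← mul_apply_eq_comp, ← map_mul, mul_mulRight, map_mul α]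

end Matching

/-! ### Sequences of irreducible representations -/

section Sequences

variable {A : Type u} [NonUnitalCStarAlgebra A] [PartialOrder A] [StarOrderedRing A]
variable {H : ℕ → Type v} [∀ n, NormedAddCommGroup (H n)] [∀ n, InnerProductSpace ℂ (H n)]
  [∀ n, CompleteSpace (H n)]
variable {K : ℕ → Type w} [∀ n, NormedAddCommGroup (K n)] [∀ n, InnerProductSpace ℂ (K n)]
  [∀ n, CompleteSpace (K n)]

/-- The sets of vector states of a sequence of representations. -/
def vecStates (π : ∀ n, A →⋆ₙₐ[ℂ] (H n →L[ℂ] H n)) (n : ℕ) : Set (A →ₚ[ℂ] ℂ) :=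
  {ω | ∃ ξ : H n, ‖ξ‖ = 1 ∧ vecState (π n) ξ = ω}

lemma isSectorSeq_vecStates {π : ∀ n, A →⋆ₙₐ[ℂ] (H n →L[ℂ] H n)} (hπ : ∀ n, IsIrreducible (π n))
    (hd : Pairwise fun m n => DisjointRep (π m) (π n)) : IsSectorSeq (vecStates π) where
  nonempty n := by
    obtain ⟨ξ, hξ⟩ := (hπ n).exists_norm_eq_one
    exact ⟨_, ξ, hξ, rfl⟩
  pure := by
    rintro n _ ⟨ξ, hξ, rfl⟩
    exact (hπ n).isPureState_vecState hξ
  equivalent := by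
    rintro n _ ⟨ξ, hξ, rfl⟩ _ ⟨η, hη, rfl⟩
    exact ((hπ n).equivalent_gns hξ).trans ((hπ n).equivalent_gns hη).symm
  disjoint := by
    rintro m n hmn _ ⟨ξ, hξ, rfl⟩ _ ⟨η, hη, rfl⟩
    exact (hd hmn).congr ((hπ m).equivalent_gns hξ).symm ((hπ n).equivalent_gns hη).symm

lemma isApproximatedBy_vecStates {π : ∀ n, A →⋆ₙₐ[ℂ] (H n →L[ℂ] H n)}
    {ρ : ∀ n, A →⋆ₙₐ[ℂ] (K n →L[ℂ] K n)} (hπ : ∀ n, IsIrreducible (π n))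
    (hker : ∀ n, repKer (ρ n) ⊆ repKer (π n)) : IsApproximatedBy (vecStates π) (vecStates ρ) := by
  rintro n _ ⟨ξ, hξ, rfl⟩ G δ hδ
  obtain ⟨η, hη, h⟩ := (hπ n).exists_vecState_close (fun a ha => hker n ha) hξ G hδ
  exact ⟨_, ⟨η, hη, rfl⟩, h⟩

end Sequences

/-- Two sequences of mutually disjoint irreducible representations with the same kernels are
conjugate under one asymptotically inner automorphism. -/
theorem exists_isAsymptoticallyInner_equivalent {A : Type u} [NonUnitalCStarAlgebra A]
    [TopologicalSpace.SeparableSpace A] (hA : StrongTransitivityProperty A)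
    {H : ℕ → Type v} [∀ n, NormedAddCommGroup (H n)] [∀ n, InnerProductSpace ℂ (H n)]
    [∀ n, CompleteSpace (H n)]
    {K : ℕ → Type w} [∀ n, NormedAddCommGroup (K n)] [∀ n, InnerProductSpace ℂ (K n)]
    [∀ n, CompleteSpace (K n)]
    {π : ∀ n, A →⋆ₙₐ[ℂ] (H n →L[ℂ] H n)} {ρ : ∀ n, A →⋆ₙₐ[ℂ] (K n →L[ℂ] K n)}
    (hπ : ∀ n, IsIrreducible (π n)) (hρ : ∀ n, IsIrreducible (ρ n))
    (hdπ : Pairwise fun m n => DisjointRep (π m) (π n))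
    (hdρ : Pairwise fun m n => DisjointRep (ρ m) (ρ n))
    (hker : ∀ n, repKer (π n) = repKer (ρ n)) :
    ∃ α : A ≃⋆ₐ[ℂ] A, IsAsymptoticallyInner α ∧
      ∀ n, Equivalent (π n) ((ρ n).comp (α : A →⋆ₙₐ[ℂ] A)) := by
  let _ := CStarAlgebra.spectralOrder A
  have := CStarAlgebra.spectralOrderedRing A
  obtain ⟨α, hα, h⟩ := exists_isAsymptoticallyInner_of_isApproximatedBy hA
    (isSectorSeq_vecStates hπ hdπ) (isSectorSeq_vecStates hρ hdρ)
    (isApproximatedBy_vecStates hπ fun n => (hker n).ge)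
    (isApproximatedBy_vecStates hρ fun n => (hker n).le)
  refine ⟨α, hα, fun n => ?_⟩
  obtain ⟨_, ⟨ξ, hξ, rfl⟩, _, ⟨η, hη, rfl⟩, u, v, huv⟩ := h n
  exact (hπ n).equivalent_comp (hρ n) (by rintro rfl; simp at hξ) (by rintro rfl; simp at hη)
    α u v huv

end PureTransitivity

end

theorem mainTheorem8 (A : Type*) [NonUnitalCStarAlgebra A]
    [TopologicalSpace.SeparableSpace A]
    (hA : PureTransitivity.StrongTransitivityProperty A) :
    (∀ (H : ℕ → Type*) (K : ℕ → Type*)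
        [∀ n, NormedAddCommGroup (H n)] [∀ n, InnerProductSpace ℂ (H n)]
        [∀ n, CompleteSpace (H n)]
        [∀ n, NormedAddCommGroup (K n)] [∀ n, InnerProductSpace ℂ (K n)]
        [∀ n, CompleteSpace (K n)]
        (π : ∀ n, A →⋆ₙₐ[ℂ] (H n →L[ℂ] H n)) (ρ : ∀ n, A →⋆ₙₐ[ℂ] (K n →L[ℂ] K n)),
        (∀ n, PureTransitivity.IsIrreducible (π n)) →
        (∀ n, PureTransitivity.IsIrreducible (ρ n)) →
        (Pairwise fun m n => PureTransitivity.DisjointRep (π m) (π n)) →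
        (Pairwise fun m n => PureTransitivity.DisjointRep (ρ m) (ρ n)) →
        (∀ n, PureTransitivity.repKer (π n) = PureTransitivity.repKer (ρ n)) →
        ∃ α : A ≃⋆ₐ[ℂ] A, PureTransitivity.IsAsymptoticallyInner α ∧
          ∀ n, PureTransitivity.Equivalent (π n) ((ρ n).comp (α : A →⋆ₙₐ[ℂ] A))) ∧
    (∀ (H : ℤ → Type*)
        [∀ n, NormedAddCommGroup (H n)] [∀ n, InnerProductSpace ℂ (H n)]
        [∀ n, CompleteSpace (H n)]
        (π : ∀ n, A →⋆ₙₐ[ℂ] (H n →L[ℂ] H n)),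
        (∀ n, PureTransitivity.IsIrreducible (π n)) →
        (Pairwise fun m n => PureTransitivity.DisjointRep (π m) (π n)) →
        (∀ m n, PureTransitivity.repKer (π m) = PureTransitivity.repKer (π n)) →
        ∃ α : A ≃⋆ₐ[ℂ] A, PureTransitivity.IsAsymptoticallyInner α ∧
          ∀ n, PureTransitivity.Equivalent ((π n).comp (α : A →⋆ₙₐ[ℂ] A)) (π (n + 1))) := by
  refine ⟨fun H K _ _ _ _ _ _ π ρ hπ hρ hdπ hdρ hker =>
    PureTransitivity.exists_isAsymptoticallyInner_equivalent hA hπ hρ hdπ hdρ hker, ?_⟩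
  intro H _ _ _ π hπ hd hker
  -- Enumerate the integers and compare the sequence with its shift.
  let e : ℕ ≃ ℤ := (Denumerable.eqv ℤ).symm
  obtain ⟨α, hα, h⟩ := PureTransitivity.exists_isAsymptoticallyInner_equivalent hA
    (π := fun n => π (e n + 1)) (ρ := fun n => π (e n)) (fun n => hπ _) (fun n => hπ _)
    (fun m n hmn => hd fun h => hmn (e.injective (add_right_cancel h)))
    (fun m n hmn => hd fun h => hmn (e.injective h)) (fun n => hker _ _)
  refine ⟨α, hα, fun n => ?_⟩
  have := h (e.symm n)
  rw [e.apply_symm_apply] at this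
  exact this.symm
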